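/- Let $k$ be a field and let $\mathcal A$ be a $k$-linear abelian category that is artinian and noetherian (every object is artinian and noetherian), has only finitely many simple objects up to isomorphism, and is split (the endomorphism algebra of every simple object is isomorphic to $k$). Let $\mathcal S$ be a finite set of objects of $\mathcal A$ that is a complete set of representatives of the isomorphism classes of simple objects, and let $\mathcal T=D^b(\mathcal A)$, in which $\mathcal A$, and hence $\mathcal S$, is placed in degree $0$. For an object $N$ of $\mathcal A$ let $\operatorname{rad}N$ be the intersection of its maximal proper subobjects, $\operatorname{rad}^0N=N$ and $\operatorname{rad}^{i+1}N=\operatorname{rad}(\operatorname{rad}^iN)$. Let $\operatorname{gr}\mathcal A$ be the category with the same objects as $\mathcal A$ and with $\operatorname{Hom}_{\operatorname{gr}\mathcal A}(M,N)=\bigoplus_{i\ge 0}\operatorname{Hom}(M,N)^i/\operatorname{Hom}(M,N)^{i+1}$, where $\operatorname{Hom}(M,N)^i=\{f\in\operatorname{Hom}_{\mathcal A}(M,N)\mid \operatorname{im} f\subseteq\operatorname{rad}^iN\}$; composition is induced by that of $\mathcal A$. Let $\mathcal F$ be the following category. Its objects are the diagrams $M=(\cdots\to M_2\xrightarrow{f_2}M_1\xrightarrow{f_1}M_0\xrightarrow{\varepsilon_0}N_0)$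 in $\mathcal T$ with $M_i=0$ for $i\gg 0$ such that (i) $M_1\xrightarrow{f_1}M_0\xrightarrow{\varepsilon_0}N_0$ is the beginning of a distinguished triangle; (ii) for all $i\ge 0$ the cone $N_i$ of $f_{i+1}$ is isomorphic to a finite direct sum of objects of $\mathcal S$; (iii) $\operatorname{Hom}(N_0,S)\to\operatorname{Hom}(M_0,S)$ is surjective for all $S\in\mathcal S$; (iv) $\operatorname{Hom}(N_i,S)\to\operatorname{Hom}(M_i,S)$ is bijective for all $S\in\mathcal S$ and $i\ge 1$. Write $\varepsilon_i:M_i\to N_i$ for the canonical maps. The maps from $M$ to $M'$ are $\operatorname{Hom}_{\mathcal F}(M,M')=\bigoplus_{i\ge 0}\operatorname{Hom}_{\mathcal F}(M,M')_i$, where $\operatorname{Hom}_{\mathcal F}(M,M')_i$ is the space of those $g\in\operatorname{Hom}_{\mathcal T}(N_0,N'_i)$ for which there is $h:M_0\to M'_i$ with $\varepsilon'_ih=g\varepsilon_0$. A map $g'\in\operatorname{Hom}_{\mathcal F}(M',M'')_j$ extends to a family of morphisms of distinguished triangles from $(M'_{a+1}\to M'_a\to N'_a\rightsquigarrow)$ to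 $(M''_{j+a+1}\to M''_{j+a}\to N''_{j+a}\rightsquigarrow)$, $a\ge 0$, whose components $g'_a:N'_a\to N''_{j+a}$ satisfy $g'_0=g'$ and depend only on $g'$; the composite of $g\in\operatorname{Hom}_{\mathcal F}(M,M')_i$ with $g'$ is $g'_i\circ g\in\operatorname{Hom}_{\mathcal F}(M,M'')_{i+j}$. Then there is a canonical functor $\operatorname{gr}\mathcal A\to\mathcal F$: it sends $M$ to the diagram $\cdots\to\operatorname{rad}^2M\to\operatorname{rad}M\to M\to M/\operatorname{rad}M$ given by the inclusions and the projection, and it is the $k$-linear functor that sends the class in degree $i$ of a map $f:M\to M'$ with image in $\operatorname{rad}^iM'$ to the map $g:N_0\to N'_i$ of degree $i$ with $g\varepsilon_0=\varepsilon'_i\bar f$, where $\bar f:M\to\operatorname{rad}^iM'$ is the map induced by $f$. This functor is an equivalence of categories. -/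

import Mathlib

open CategoryTheory CategoryTheory.Limits CategoryTheory.Pretriangulated

universe t w v u

namespace RadicalGraded

/-! ### Filtered objects in a triangulated category -/

section FilteredObjects

variable {T : Type u} [Category.{v} T] [Preadditive T] [HasZeroObject T] [HasShift T ℤ]
  [∀ n : ℤ, (shiftFunctor T n).Additive] [Pretriangulated T]

/-- `AddClosure S` is the class `add S` of objects isomorphic to finite direct sums of objects
of `S`. -/
def AddClosure (S : ObjectProperty T) : ObjectProperty T := fun X =>
  ∃ (n : ℕ) (F : Fin n → T) (b : Bicone F),
    (∀ i, S (F i)) ∧ Nonempty b.IsBilimit ∧ Nonempty (X ≅ b.pt)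

variable (T) in
/-- A diagram `⋯ ⟶ M₂ ⟶ M₁ ⟶ M₀ ⟶ N₀`. -/
structure Diagram where
  /-- the objects `Mᵢ` -/
  M : ℕ → T
  /-- the maps `fᵢ₊₁ : Mᵢ₊₁ ⟶ Mᵢ` -/
  f : ∀ i, M (i + 1) ⟶ M i
  /-- the object `N₀` -/
  N₀ : T
  /-- the map `ε₀ : M₀ ⟶ N₀` -/
  ε₀ : M 0 ⟶ N₀

namespace Diagram

variable (D : Diagram T)

/-- `M₁ ⟶ M₀ ⟶ N₀` is the beginning of a distinguished triangle. -/
def IsTriangle₀ : Prop := ∃ δ : D.N₀ ⟶ (D.M 1)⟦(1 : ℤ)⟧, Triangle.mk (D.f 0) D.ε₀ δ ∈ distTriang T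

/-- The object `Nᵢ`: it is the given object `N₀` if `i = 0`, and a cone of `fᵢ₊₁` if `i ≥ 1`. -/
noncomputable def N : ℕ → T
  | 0 => D.N₀
  | i + 1 => (distinguished_cocone_triangle (D.f (i + 1))).choose

/-- The map `εᵢ : Mᵢ ⟶ Nᵢ`. -/
noncomputable def ε : ∀ i, D.M i ⟶ D.N i
  | 0 => D.ε₀
  | i + 1 => (distinguished_cocone_triangle (D.f (i + 1))).choose_spec.choose

open Classical in
/-- The connecting map `Nᵢ ⟶ Mᵢ₊₁[1]` of the distinguished triangle on `fᵢ₊₁` and `εᵢ`. -/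
noncomputable def δ : ∀ i, D.N i ⟶ (D.M (i + 1))⟦(1 : ℤ)⟧
  | 0 => if h : D.IsTriangle₀ then h.choose else 0
  | i + 1 => (distinguished_cocone_triangle (D.f (i + 1))).choose_spec.choose_spec.choose

/-- The conditions that single out the objects of the category of filtered objects among all
diagrams. -/
structure IsFiltered (S : ObjectProperty T) : Prop where
  /-- `Mᵢ = 0` for `i ≫ 0` -/
  eventually_isZero : ∃ n, ∀ i ≥ n, IsZero (D.M i)
  /-- `M₁ ⟶ M₀ ⟶ N₀` is the beginning of a distinguished triangle -/
  isTriangle₀ : D.IsTriangle₀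
  /-- the cone `Nᵢ` of `fᵢ₊₁` is in `add S` -/
  add : ∀ i, AddClosure S (D.N i)
  /-- `Hom(N₀, X) ⟶ Hom(M₀, X)` is surjective for `X ∈ S` -/
  surjective₀ : ∀ X, S X → Function.Surjective (fun r : D.N 0 ⟶ X => D.ε 0 ≫ r)
  /-- `Hom(Nᵢ, X) ⟶ Hom(Mᵢ, X)` is bijective for `X ∈ S` and `i ≥ 1` -/
  bijective : ∀ i X, S X → Function.Bijective (fun r : D.N (i + 1) ⟶ X => D.ε (i + 1) ≫ r)

variable {D} {S : ObjectProperty T}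

lemma IsFiltered.triangle (hD : D.IsFiltered S) (i : ℕ) :
    Triangle.mk (D.f i) (D.ε i) (D.δ i) ∈ distTriang T := by
  cases i with
  | zero =>
    have h := hD.isTriangle₀
    have e : D.δ 0 = h.choose := dif_pos h
    rw [e]
    exact h.choose_spec
  | succ i =>
    exact (distinguished_cocone_triangle (D.f (i + 1))).choose_spec.choose_spec.choose_spec

lemma IsFiltered.exists_lift (hD : D.IsFiltered S) (i : ℕ) {X : T} (hX : AddClosure S X)
    (φ : D.M i ⟶ X) : ∃ r : D.N i ⟶ X, D.ε i ≫ r = φ := by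
  have key : ∀ Y, S Y → ∀ ψ : D.M i ⟶ Y, ∃ r : D.N i ⟶ Y, D.ε i ≫ r = ψ := by
    intro Y hY ψ
    cases i with
    | zero => exact hD.surjective₀ Y hY ψ
    | succ i => exact (hD.bijective i Y hY).2 ψ
  obtain ⟨n, F, b, hF, ⟨hb⟩, ⟨e⟩⟩ := hX
  choose r hr using fun j => key (F j) (hF j) (φ ≫ e.hom ≫ b.π j)
  refine ⟨(∑ j, r j ≫ b.ι j) ≫ e.inv, ?_⟩
  rw [Preadditive.sum_comp, Preadditive.comp_sum, ← cancel_mono e.hom]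
  simp only [Category.assoc, Preadditive.sum_comp, e.inv_hom_id, Category.comp_id]
  simp only [← Category.assoc, hr]
  simp only [Category.assoc, ← Preadditive.comp_sum]
  rw [IsBilimit.total hb, Category.comp_id]

lemma IsFiltered.eq_zero (hD : D.IsFiltered S) (i : ℕ) {X : T} (hX : AddClosure S X)
    (r : D.N (i + 1) ⟶ X) (hr : D.ε (i + 1) ≫ r = 0) : r = 0 := by
  obtain ⟨n, F, b, hF, ⟨hb⟩, ⟨e⟩⟩ := hX
  have h0 : ∀ j, r ≫ e.hom ≫ b.π j = 0 := fun j =>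
    (hD.bijective i (F j) (hF j)).1 (by
      change D.ε (i + 1) ≫ r ≫ e.hom ≫ b.π j = D.ε (i + 1) ≫ 0
      rw [reassoc_of% hr, zero_comp, comp_zero])
  have h1 : r ≫ e.hom = 0 := by
    rw [← Category.comp_id (r ≫ e.hom), ← IsBilimit.total hb, Preadditive.comp_sum]
    refine Finset.sum_eq_zero fun j _ => ?_
    rw [← Category.assoc, Category.assoc r, h0, zero_comp]
  rw [← cancel_mono e.hom, h1, zero_comp]

end Diagram

/-- A ladder of degree `j`: maps `h : Mₐ ⟶ M'ⱼ₊ₐ` and `g : Nₐ ⟶ N'ⱼ₊ₐ` that form morphisms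
between the distinguished triangles of `D` and of `D'`. -/
structure Ladder (D D' : Diagram T) (j : ℕ) where
  /-- the maps on the objects `Mₐ` -/
  h : ∀ a b, j + a = b → (D.M a ⟶ D'.M b)
  /-- the maps on the objects `Nₐ` -/
  g : ∀ a b, j + a = b → (D.N a ⟶ D'.N b)
  comm₁ : ∀ a b (e : j + a = b),
    D.f a ≫ h a b e = h (a + 1) (b + 1) (by omega) ≫ D'.f b
  comm₂ : ∀ a b (e : j + a = b), D.ε a ≫ g a b e = h a b e ≫ D'.ε b
  comm₃ : ∀ a b (e : j + a = b),
    D.δ a ≫ (h (a + 1) (b + 1) (by omega))⟦(1 : ℤ)⟧' = g a b e ≫ D'.δ b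

namespace Ladder

variable {D D' D'' : Diagram T} {j l : ℕ} {S : ObjectProperty T}

/-- The identity ladder. -/
noncomputable def id (D : Diagram T) : Ladder D D 0 where
  h a b e := eqToHom (by rw [← e, zero_add])
  g a b e := eqToHom (by rw [← e, zero_add])
  comm₁ a b e := by obtain rfl : a = b := by omega
                    simp
  comm₂ a b e := by obtain rfl : a = b := by omega
                    simp
  comm₃ a b e := by obtain rfl : a = b := by omega
                    simp

/-- The composition of ladders. -/
noncomputable def comp (L : Ladder D D' j) (L' : Ladder D' D'' l) : Ladder D D'' (l + j) where
  h a b e := L.h a (j + a) rfl ≫ L'.h (j + a) b (by omega)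
  g a b e := L.g a (j + a) rfl ≫ L'.g (j + a) b (by omega)
  comm₁ a b e := by
    have h1 := L.comm₁ a (j + a) rfl
    have h2 := L'.comm₁ (j + a) b (by omega)
    rw [reassoc_of% h1, h2, Category.assoc]
    rfl
  comm₂ a b e := by
    have h1 := L.comm₂ a (j + a) rfl
    have h2 := L'.comm₂ (j + a) b (by omega)
    rw [reassoc_of% h1, h2, Category.assoc]
  comm₃ a b e := by
    have h1 := L.comm₃ a (j + a) rfl
    have h2 := L'.comm₃ (j + a) b (by omega)
    rw [Functor.map_comp]
    change D.δ a ≫ (L.h (a + 1) (j + a + 1) _)⟦(1 : ℤ)⟧' ≫ (L'.h (j + a + 1) (b + 1) _)⟦(1 : ℤ)⟧' = _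
    rw [reassoc_of% h1, h2, Category.assoc]

/-- The sum of two ladders. -/
noncomputable def add (L L' : Ladder D D' j) : Ladder D D' j where
  h a b e := L.h a b e + L'.h a b e
  g a b e := L.g a b e + L'.g a b e
  comm₁ a b e := by simp [L.comm₁ a b e, L'.comm₁ a b e]
  comm₂ a b e := by simp [L.comm₂ a b e, L'.comm₂ a b e]
  comm₃ a b e := by simp [L.comm₃ a b e, L'.comm₃ a b e, Functor.map_add]

/-- The difference of two ladders. -/
noncomputable def sub (L L' : Ladder D D' j) : Ladder D D' j where
  h a b e := L.h a b e - L'.h a b e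
  g a b e := L.g a b e - L'.g a b e
  comm₁ a b e := by simp [L.comm₁ a b e, L'.comm₁ a b e]
  comm₂ a b e := by simp [L.comm₂ a b e, L'.comm₂ a b e]
  comm₃ a b e := by simp [L.comm₃ a b e, L'.comm₃ a b e, Functor.map_sub]

lemma g_eq_zero (hD : D.IsFiltered S) (hD' : D'.IsFiltered S) (L : Ladder D D' j)
    (h0 : L.g 0 j rfl = 0) (a : ℕ) : L.g a (j + a) rfl = 0 := by
  induction a with
  | zero => exact h0
  | succ a ih =>
    have h3 := L.comm₃ a (j + a) rfl
    rw [ih, zero_comp] at h3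
    obtain ⟨p', hp'⟩ := Triangle.yoneda_exact₃ _ (rot_of_distTriang _ (hD.triangle a))
      ((L.h (a + 1) (j + a + 1) (by omega))⟦(1 : ℤ)⟧') h3
    obtain ⟨p, rfl⟩ : ∃ p : D.M a ⟶ D'.M (j + a + 1), (shiftFunctor T (1 : ℤ)).map p = p' :=
      (shiftFunctor T (1 : ℤ)).map_surjective p'
    have hp : L.h (a + 1) (j + a + 1) (by omega) = -(D.f a ≫ p) := by
      apply (shiftFunctor T (1 : ℤ)).map_injective
      refine hp'.trans ?_
      rw [Functor.map_neg, Functor.map_comp]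
      exact Preadditive.neg_comp _ _
    obtain ⟨r, hr⟩ := hD.exists_lift a (hD'.add (j + a + 1)) (p ≫ D'.ε (j + a + 1))
    have hz : D.f a ≫ D.ε a = 0 := comp_distTriang_mor_zero₁₂ _ (hD.triangle a)
    refine hD.eq_zero a (hD'.add _) _ ?_
    rw [L.comm₂ (a + 1) (j + (a + 1)) rfl]
    change L.h (a + 1) (j + a + 1) _ ≫ D'.ε (j + a + 1) = 0
    rw [hp, Preadditive.neg_comp, Category.assoc, ← hr, reassoc_of% hz, zero_comp, neg_zero]

/-- The maps `gₐ` of a ladder depend only on `g₀`. -/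
lemma g_unique (hD : D.IsFiltered S) (hD' : D'.IsFiltered S) (L L' : Ladder D D' j)
    (h0 : L.g 0 j rfl = L'.g 0 j rfl) (a b : ℕ) (e : j + a = b) : L.g a b e = L'.g a b e := by
  subst e
  exact sub_eq_zero.1 (g_eq_zero hD hD' (L.sub L') (sub_eq_zero.2 h0) a)

lemma exists_step (hD : D.IsFiltered S) (hD' : D'.IsFiltered S) (a b : ℕ)
    (h : D.M a ⟶ D'.M b) (g : D.N a ⟶ D'.N b) (hg : D.ε a ≫ g = h ≫ D'.ε b) :
    ∃ (h' : D.M (a + 1) ⟶ D'.M (b + 1)) (g' : D.N (a + 1) ⟶ D'.N (b + 1)),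
      D.f a ≫ h = h' ≫ D'.f b ∧ D.δ a ≫ h'⟦(1 : ℤ)⟧' = g ≫ D'.δ b ∧
        D.ε (a + 1) ≫ g' = h' ≫ D'.ε (b + 1) := by
  obtain ⟨h', h1, h3⟩ := complete_distinguished_triangle_morphism₁ _ _ (hD.triangle a)
    (hD'.triangle b) h g hg
  obtain ⟨g', hg'⟩ := hD.exists_lift (a + 1) (hD'.add (b + 1)) (h' ≫ D'.ε (b + 1))
  exact ⟨h', g', h1, h3, hg'⟩

/-- A map `g₀` that lifts to `M₀` extends to a ladder. -/
lemma exists_extension (hD : D.IsFiltered S) (hD' : D'.IsFiltered S) (h₀ : D.M 0 ⟶ D'.M j)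
    (g₀ : D.N 0 ⟶ D'.N j) (hg : D.ε 0 ≫ g₀ = h₀ ≫ D'.ε j) :
    ∃ L : Ladder D D' j, L.g 0 j rfl = g₀ ∧ L.h 0 j rfl = h₀ := by
  choose h' g' c₁ c₃ c₂ using exists_step (S := S) hD hD'
  let step : ∀ a, { p : (D.M a ⟶ D'.M (j + a)) × (D.N a ⟶ D'.N (j + a)) //
      D.ε a ≫ p.2 = p.1 ≫ D'.ε (j + a) } := fun a =>
    Nat.rec ⟨(h₀, g₀), hg⟩ (fun a p =>
      ⟨(h' a (j + a) p.1.1 p.1.2 p.2, g' a (j + a) p.1.1 p.1.2 p.2), c₂ a (j + a) _ _ p.2⟩) a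
  refine ⟨{ h := fun a b e => (step a).1.1 ≫ eqToHom (by rw [e])
            g := fun a b e => (step a).1.2 ≫ eqToHom (by rw [e])
            comm₁ := ?_
            comm₂ := ?_
            comm₃ := ?_ }, ?_, ?_⟩
  · rintro a _ rfl
    simpa using c₁ a (j + a) _ _ (step a).2
  · rintro a _ rfl
    simpa using (step a).2
  · rintro a _ rfl
    simpa using c₃ a (j + a) _ _ (step a).2
  · exact Category.comp_id _
  · exact Category.comp_id _

end Ladder

variable (k : Type t) [Field k] [Linear k T]

/-- The degree `i` part of the space of maps from `D` to `D'`: the maps `g : N₀ ⟶ N'ᵢ` that lift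
to a map `h : M₀ ⟶ M'ᵢ`. -/
def homPart (D D' : Diagram T) (i : ℕ) : Submodule k (D.N 0 ⟶ D'.N i) where
  carrier := { g | ∃ h : D.M 0 ⟶ D'.M i, h ≫ D'.ε i = D.ε 0 ≫ g }
  zero_mem' := ⟨0, by simp⟩
  add_mem' := by
    rintro g g' ⟨h, hh⟩ ⟨h', hh'⟩
    exact ⟨h + h', by simp [hh, hh']⟩
  smul_mem' := by
    rintro c g ⟨h, hh⟩
    exact ⟨c • h, by simp [hh]⟩

/-- The space of maps from `D` to `D'`, as a graded vector space. -/
abbrev DHom (D D' : Diagram T) := DirectSum ℕ (fun i => homPart k D D' i)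

section Composition

variable {k} {S : ObjectProperty T} {D D' D'' D''' : Diagram T}

/-- The ladder on a map of degree `j`. -/
noncomputable def ladder (hD : D.IsFiltered S) (hD' : D'.IsFiltered S) {j : ℕ}
    (g : homPart k D D' j) : Ladder D D' j :=
  (Ladder.exists_extension hD hD' g.2.choose g.1 g.2.choose_spec.symm).choose

/-- The map `gₐ : Nₐ ⟶ N'ⱼ₊ₐ` induced by a map `g = g₀` of degree `j`. -/
noncomputable def induced (hD : D.IsFiltered S) (hD' : D'.IsFiltered S) {j : ℕ}
    (g : homPart k D D' j) (a b : ℕ) (e : j + a = b) : D.N a ⟶ D'.N b :=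
  (ladder hD hD' g).g a b e

lemma ladder_zero (hD : D.IsFiltered S) (hD' : D'.IsFiltered S) {j : ℕ}
    (g : homPart k D D' j) : (ladder hD hD' g).g 0 j rfl = g.1 :=
  (Ladder.exists_extension hD hD' g.2.choose g.1 g.2.choose_spec.symm).choose_spec.1

lemma induced_eq (hD : D.IsFiltered S) (hD' : D'.IsFiltered S) {j : ℕ}
    (g : homPart k D D' j) (L : Ladder D D' j) (hL : L.g 0 j rfl = g.1) (a b : ℕ)
    (e : j + a = b) : induced hD hD' g a b e = L.g a b e :=
  Ladder.g_unique hD hD' _ _ ((ladder_zero hD hD' g).trans hL.symm) a b e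

lemma induced_add (hD : D.IsFiltered S) (hD' : D'.IsFiltered S) {j : ℕ}
    (g g' : homPart k D D' j) (a b : ℕ) (e : j + a = b) :
    induced hD hD' (g + g') a b e = induced hD hD' g a b e + induced hD hD' g' a b e :=
  induced_eq hD hD' (g + g') ((ladder hD hD' g).add (ladder hD hD' g'))
    (congrArg₂ (· + ·) (ladder_zero hD hD' g) (ladder_zero hD hD' g')) a b e

/-- A scalar multiple of a map still has a ladder; its maps `gₐ` are the scalar multiples. -/
lemma induced_smul [∀ n : ℤ, (shiftFunctor T n).Linear k]
    (hD : D.IsFiltered S) (hD' : D'.IsFiltered S) {j : ℕ}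
    (c : k) (g : homPart k D D' j) (a b : ℕ) (e : j + a = b) :
    induced hD hD' (c • g) a b e = c • induced hD hD' g a b e := by
  let L := ladder hD hD' g
  let L' : Ladder D D' j :=
    { h := fun a b e => c • L.h a b e
      g := fun a b e => c • L.g a b e
      comm₁ := fun a b e => by simp [L.comm₁ a b e]
      comm₂ := fun a b e => by simp [L.comm₂ a b e]
      comm₃ := fun a b e => by simp [L.comm₃ a b e, Functor.map_smul] }
  exact induced_eq hD hD' (c • g) L' (congrArg (c • ·) (ladder_zero hD hD' g)) a b e

variable [∀ n : ℤ, (shiftFunctor T n).Linear k]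

/-- The composition of maps `g` of degree `i` and `g'` of degree `j`, namely
`N₀ ⟶ N'ᵢ ⟶ N''ⱼ₊ᵢ` with the maps `g₀` and `g'ᵢ`. -/
noncomputable def compPart (hD' : D'.IsFiltered S)
    (hD'' : D''.IsFiltered S) (i j n : ℕ) (e : j + i = n) :
    homPart k D D' i →ₗ[k] homPart k D' D'' j →ₗ[k] homPart k D D'' n :=
  LinearMap.mk₂ k
    (fun g g' => ⟨g.1 ≫ induced hD' hD'' g' i n e, by
      obtain ⟨h, hh⟩ := g.2
      refine ⟨h ≫ (ladder hD' hD'' g').h i n e, ?_⟩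
      rw [Category.assoc, ← (ladder hD' hD'' g').comm₂ i n e, reassoc_of% hh]
      rfl⟩)
    (fun g₁ g₂ g' => Subtype.ext (Preadditive.add_comp _ _ _ _ _ _))
    (fun c g g' => Subtype.ext (Linear.smul_comp _ _ _ _ _ _))
    (fun g g₁ g₂ => Subtype.ext (by
      change g.1 ≫ _ = g.1 ≫ _ + g.1 ≫ _
      rw [induced_add, Preadditive.comp_add]))
    (fun c g g' => Subtype.ext (by
      change g.1 ≫ _ = c • (g.1 ≫ _)
      rw [induced_smul, Linear.comp_smul]))

/-- The composition of maps of filtered objects. -/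
noncomputable def dComp (D : Diagram T) (hD' : D'.IsFiltered S) (hD'' : D''.IsFiltered S) :
    DHom k D D' →ₗ[k] DHom k D' D'' →ₗ[k] DHom k D D'' :=
  DirectSum.toModule k ℕ _ fun i => LinearMap.flip <| DirectSum.toModule k ℕ _ fun j =>
    LinearMap.flip <| (compPart hD' hD'' i j (j + i) rfl).compr₂
      (DirectSum.lof k ℕ (fun n => homPart k D D'' n) (j + i))

lemma dComp_lof (hD' : D'.IsFiltered S) (hD'' : D''.IsFiltered S) (i j n : ℕ) (e : j + i = n)
    (g : homPart k D D' i) (g' : homPart k D' D'' j) :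
    dComp D hD' hD'' (DirectSum.lof k ℕ (fun i => homPart k D D' i) i g)
      (DirectSum.lof k ℕ (fun i => homPart k D' D'' i) j g') =
    DirectSum.lof k ℕ (fun i => homPart k D D'' i) n (compPart hD' hD'' i j n e g g') := by
  subst e
  simp [dComp, DirectSum.toModule_lof]

/-- The identity map. -/
noncomputable def dId (D : Diagram T) : DHom k D D :=
  DirectSum.lof k ℕ (fun i => homPart k D D i) 0
    ⟨𝟙 (D.N 0), 𝟙 (D.M 0), by rw [Category.id_comp, Category.comp_id]⟩

lemma dId_comp (hD : D.IsFiltered S) (hD' : D'.IsFiltered S) (y : DHom k D D') :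
    dComp D hD hD' (dId D) y = y := by
  suffices h : dComp (k := k) D hD hD' (dId D) = LinearMap.id from LinearMap.congr_fun h y
  refine DirectSum.linearMap_ext _ fun j => LinearMap.ext fun g => ?_
  simp only [LinearMap.comp_apply, LinearMap.id_apply]
  rw [dId, dComp_lof hD hD' 0 j j rfl]
  congr 1
  refine Subtype.ext ?_
  change 𝟙 _ ≫ (ladder hD hD' g).g 0 j rfl = _
  rw [ladder_zero, Category.id_comp]

lemma dComp_id (hD' : D'.IsFiltered S) (x : DHom k D D') :
    dComp D hD' hD' x (dId D') = x := by
  suffices h : (dComp (k := k) D hD' hD').flip (dId D') = LinearMap.id from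
    LinearMap.congr_fun h x
  refine DirectSum.linearMap_ext _ fun i => LinearMap.ext fun g => ?_
  simp only [LinearMap.comp_apply, LinearMap.id_apply, LinearMap.flip_apply]
  rw [dId, dComp_lof hD' hD' i 0 i (zero_add i)]
  congr 1
  refine Subtype.ext ?_
  change g.1 ≫ induced hD' hD' _ i i _ = g.1
  rw [induced_eq hD' hD' _ (Ladder.id D') rfl]
  exact Category.comp_id _

lemma dComp_assoc (hD' : D'.IsFiltered S) (hD'' : D''.IsFiltered S) (hD''' : D'''.IsFiltered S)
    (x : DHom k D D') (y : DHom k D' D'') (z : DHom k D'' D''') :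
    dComp D hD'' hD''' (dComp D hD' hD'' x y) z =
      dComp D hD' hD''' x (dComp D' hD'' hD''' y z) := by
  induction x using DirectSum.induction_on with
  | zero => simp
  | add x x' h h' => simp only [map_add, LinearMap.add_apply, h, h']
  | of i g =>
  induction y using DirectSum.induction_on with
  | zero => simp
  | add x x' h h' => simp only [map_add, LinearMap.add_apply, h, h']
  | of j g' =>
  induction z using DirectSum.induction_on with
  | zero => simp
  | add x x' h h' => simp only [map_add, h, h']
  | of l g'' =>
  simp only [← DirectSum.lof_eq_of k]
  rw [dComp_lof hD' hD'' i j (j + i) rfl, dComp_lof hD'' hD''' j l (l + j) rfl,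
    dComp_lof hD'' hD''' (j + i) l (l + (j + i)) rfl,
    dComp_lof hD' hD''' i (l + j) (l + (j + i)) (by omega)]
  congr 1
  refine Subtype.ext ?_
  change (g.1 ≫ induced hD' hD'' g' i (j + i) rfl) ≫ induced hD'' hD''' g'' (j + i) _ rfl =
    g.1 ≫ induced hD' hD''' _ i _ _
  rw [induced_eq hD' hD''' (compPart hD'' hD''' j l (l + j) rfl g' g'')
    ((ladder hD' hD'' g').comp (ladder hD'' hD''' g'')) ?_, Category.assoc]
  · rfl
  · change (ladder hD' hD'' g').g 0 j rfl ≫ (ladder hD'' hD''' g'').g j (l + j) _ = _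
    rw [ladder_zero]
    rfl

end Composition

/-- An object of the category `ℱ` of filtered objects attached to the class of objects `S` of the
`k`-linear triangulated category `T` (the field `k` is recorded for the `k`-linear structure). -/
@[nolint unusedArguments]
structure FilteredObject (k : Type t) [Field k] [Linear k T] (S : ObjectProperty T) where
  /-- the underlying diagram -/
  diagram : Diagram T
  isFiltered : diagram.IsFiltered S

namespace FilteredObject

variable {k} [∀ n : ℤ, (shiftFunctor T n).Linear k] {S : ObjectProperty T}

noncomputable instance : Category (FilteredObject k S) where
  Hom M M' := DHom k M.diagram M'.diagram
  id M := dId M.diagram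
  comp {M M' M''} x y := dComp M.diagram M'.isFiltered M''.isFiltered x y
  id_comp {M M'} y := dId_comp M.isFiltered M'.isFiltered y
  comp_id {_ M'} x := dComp_id M'.isFiltered x
  assoc {_ M' M'' M'''} x y z := dComp_assoc M'.isFiltered M''.isFiltered M'''.isFiltered x y z

noncomputable instance : Preadditive (FilteredObject k S) where
  homGroup M M' := inferInstanceAs (AddCommGroup (DHom k M.diagram M'.diagram))
  add_comp M M' M'' x x' y :=
    (dComp M.diagram M'.isFiltered M''.isFiltered).map_add₂ x x' y
  comp_add M M' M'' x y y' :=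
    (dComp M.diagram M'.isFiltered M''.isFiltered x).map_add y y'

noncomputable instance : Linear k (FilteredObject k S) where
  homModule M M' := inferInstanceAs (Module k (DHom k M.diagram M'.diagram))
  smul_comp M M' M'' c x y :=
    (dComp M.diagram M'.isFiltered M''.isFiltered).map_smul₂ c x y
  comp_smul M M' M'' x c y :=
    (dComp M.diagram M'.isFiltered M''.isFiltered x).map_smul c y

end FilteredObject

end FilteredObjects

/-! ### The graded category of an abelian category -/

section Radical

variable {A : Type u} [Category.{v} A] [Abelian A]

lemma simple_cokernel {X : A} {P : Subobject X} (hP : IsCoatom P) :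
    Simple (cokernel P.arrow) := by
  have hfac : ∀ {W : A} (w : W ⟶ X), w ≫ cokernel.π P.arrow = 0 → P.Factors w := by
    intro W w hw
    have h := Subobject.factors_comp_arrow (P := P) (Abelian.monoLift P.arrow w hw)
    rwa [Abelian.monoLift_comp] at h
  refine ⟨fun {Z} m _ => ⟨fun _ hm => ?_, fun hm => ?_⟩⟩
  · subst hm
    have h1 : cokernel.π P.arrow = 0 := by
      rw [← Category.comp_id (cokernel.π P.arrow), ← IsIso.inv_hom_id (0 : Z ⟶ cokernel P.arrow),
        comp_zero, comp_zero]
    have h2 := hfac (𝟙 X) (by rw [h1, comp_zero])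
    exact hP.1 (top_unique ((Subobject.le_of_comm (P.factorThru _ h2 |> fun s =>
      (⊤ : Subobject X).arrow ≫ s) (by simp))))
  · let R := kernelSubobject (cokernel.π P.arrow ≫ cokernel.π m)
    have hPR : P ≤ R := le_kernelSubobject _ _ (by rw [cokernel.condition_assoc, zero_comp])
    rcases eq_or_lt_of_le hPR with he | hlt
    · exfalso
      apply hm
      have hf : pullback.snd m (cokernel.π P.arrow) ≫ cokernel.π P.arrow ≫ cokernel.π m = 0 := by
        rw [← pullback.condition_assoc, cokernel.condition, comp_zero]
      have hR : R.Factors (pullback.snd m (cokernel.π P.arrow)) :=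
        (kernelSubobject_factors_iff _ _).2 hf
      rw [← he] at hR
      have h0 : pullback.snd m (cokernel.π P.arrow) ≫ cokernel.π P.arrow = 0 := by
        rw [← P.factorThru_arrow _ hR, Category.assoc, cokernel.condition, comp_zero]
      rw [← pullback.condition] at h0
      exact (cancel_epi (pullback.fst m (cokernel.π P.arrow))).1 (h0.trans comp_zero.symm)
    · have hR := hP.2 R hlt
      have h0 : cokernel.π P.arrow ≫ cokernel.π m = 0 := by
        have hf : R.Factors (𝟙 X) := by rw [hR]; exact Subobject.top_factors _
        simpa using (kernelSubobject_factors_iff _ _).1 hf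
      have h1 : cokernel.π m = 0 :=
        (cancel_epi (cokernel.π P.arrow)).1 (h0.trans comp_zero.symm)
      have := Preadditive.epi_of_cokernel_zero h1
      exact isIso_of_mono_of_epi m

lemma isCoatom_kernel {X S : A} [Simple S] (e : X ⟶ S) (he : e ≠ 0) :
    IsCoatom (kernelSubobject e) := by
  have : Epi e := epi_of_nonzero_to_simple he
  refine ⟨fun h => he ?_, fun R hR => ?_⟩
  · have hf : (kernelSubobject e).Factors (𝟙 X) := by rw [h]; exact Subobject.top_factors _
    simpa using (kernelSubobject_factors_iff _ _).1 hf
  · have hne : R.arrow ≫ e ≠ 0 := fun h => not_le_of_gt hR (le_kernelSubobject _ _ h)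
    have : Epi (R.arrow ≫ e) := epi_of_nonzero_to_simple hne
    have : Epi R.arrow := by
      refine Preadditive.epi_of_cancel_zero _ fun {W} t ht => ?_
      have hk : (kernelSubobject e).arrow ≫ t = 0 := by
        rw [← Subobject.ofLE_arrow hR.le, Category.assoc, ht, comp_zero]
      have hk' : kernel.ι e ≫ t = 0 := by
        rw [← kernelSubobject_arrow' e, Category.assoc, hk, comp_zero]
      have hd : e ≫ Abelian.epiDesc e t hk' = t := Abelian.comp_epiDesc ..
      rw [← hd, ← Category.assoc] at ht
      rw [← hd, (cancel_epi (R.arrow ≫ e)).1 (ht.trans comp_zero.symm), comp_zero]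
    have : IsIso R.arrow := isIso_of_mono_of_epi _
    exact Subobject.eq_top_of_isIso_arrow R

lemma exists_isGLB_coatoms (X : A) [IsArtinianObject X] :
    ∃ R : Subobject X, IsGLB { P : Subobject X | IsCoatom P } R := by
  classical
  let s : Set (Subobject X) :=
    { R | ∃ F : Finset (Subobject X), (∀ P ∈ F, IsCoatom P) ∧ F.inf _root_.id = R }
  obtain ⟨R, ⟨F, hF, rfl⟩, hmin⟩ := WellFounded.has_min (r := (· < ·))
    (wellFounded_lt (α := Subobject X)) s ⟨⊤, ∅, by simp, by simp⟩
  refine ⟨F.inf _root_.id, fun P hP => ?_, fun Q hQ => ?_⟩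
  · have h := hmin ((insert P F).inf _root_.id) ⟨insert P F, by
      intro Q hQ
      rcases Finset.mem_insert.1 hQ with rfl | hQ
      exacts [hP, hF Q hQ], rfl⟩
    rw [Finset.inf_insert] at h
    by_contra hc
    exact h (lt_of_le_of_ne inf_le_right fun he => hc (by
      rw [← he]; exact inf_le_left))
  · exact Finset.le_inf fun P hP => hQ (hF P hP)

/-- The radical of an object: the intersection of its maximal proper subobjects. -/
noncomputable def radical (X : A) [IsArtinianObject X] : Subobject X :=
  (exists_isGLB_coatoms X).choose

lemma radical_isGLB (X : A) [IsArtinianObject X] :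
    IsGLB { P : Subobject X | IsCoatom P } (radical X) :=
  (exists_isGLB_coatoms X).choose_spec

lemma radical_comp_eq_zero {X S : A} [IsArtinianObject X] [Simple S] (e : X ⟶ S) :
    (radical X).arrow ≫ e = 0 := by
  by_cases he : e = 0
  · rw [he, comp_zero]
  · have h := (radical_isGLB X).1 (isCoatom_kernel e he)
    rw [← Subobject.ofLE_arrow h, Category.assoc, kernelSubobject_arrow_comp, comp_zero]

lemma radical_functorial {X Y : A} [IsArtinianObject X] [IsArtinianObject Y] (φ : X ⟶ Y) :
    ∃ ψ : (radical X : A) ⟶ (radical Y : A), ψ ≫ (radical Y).arrow = (radical X).arrow ≫ φ := by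
  have h : imageSubobject ((radical X).arrow ≫ φ) ≤ radical Y := by
    refine (radical_isGLB Y).2 fun P hP => imageSubobject_le _
      (Abelian.monoLift P.arrow ((radical X).arrow ≫ φ) ?_) (Abelian.monoLift_comp _ _ _)
    have := simple_cokernel hP
    rw [Category.assoc, radical_comp_eq_zero]
  exact ⟨factorThruImageSubobject _ ≫ Subobject.ofLE _ _ h, by simp⟩

variable [∀ X : A, IsArtinianObject X]

/-- The object `radⁱ X`. -/
noncomputable def radPow (X : A) : ℕ → A
  | 0 => X
  | i + 1 => (radical (radPow X i) : A)

/-- The inclusion `radⁱ⁺¹ X ⟶ radⁱ X`. -/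
noncomputable def radIncl (X : A) (i : ℕ) : radPow X (i + 1) ⟶ radPow X i :=
  (radical (radPow X i)).arrow

/-- The inclusion `radⁱ X ⟶ X`. -/
noncomputable def radPowι (X : A) : ∀ i, radPow X i ⟶ X
  | 0 => 𝟙 X
  | i + 1 => radIncl X i ≫ radPowι X i

/-- A map `Y ⟶ Z` whose image is contained in `radʲ Z` sends `radⁱ Y` to `radʲ⁺ⁱ Z`. -/
lemma radPow_functorial {Y Z : A} (j : ℕ) (φ : Y ⟶ radPow Z j) (i : ℕ) :
    ∃ ψ : radPow Y i ⟶ radPow Z (j + i),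
      ψ ≫ radPowι Z (j + i) = radPowι Y i ≫ φ ≫ radPowι Z j := by
  induction i with
  | zero => exact ⟨φ, (Category.id_comp _).symm⟩
  | succ i ih =>
    obtain ⟨ψ, hψ⟩ := ih
    obtain ⟨χ, hχ⟩ := radical_functorial ψ
    refine ⟨χ, ?_⟩
    change χ ≫ (radical (radPow Z (j + i))).arrow ≫ radPowι Z (j + i) =
      ((radical (radPow Y i)).arrow ≫ radPowι Y i) ≫ _
    rw [reassoc_of% hχ, hψ, Category.assoc]

variable (k : Type t) [Field k] [Linear k A]

/-- The subspace `Hom(X, Y)ⁱ` of the maps whose image is contained in `radⁱ Y`, that is, of the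
maps that factor through the inclusion `radⁱ Y ⟶ Y`. -/
noncomputable def radHom (X Y : A) (i : ℕ) : Submodule k (X ⟶ Y) :=
  LinearMap.range (Linear.rightComp k X (radPowι Y i))

variable {k}

lemma mem_radHom {X Y : A} {i : ℕ} {φ : X ⟶ Y} :
    φ ∈ radHom k X Y i ↔ ∃ ψ : X ⟶ radPow Y i, ψ ≫ radPowι Y i = φ := Iff.rfl

lemma comp_mem_radHom {X Y Z : A} {i j n : ℕ} (e : j + i = n) {φ : X ⟶ Y} {φ' : Y ⟶ Z}
    (h : φ ∈ radHom k X Y i) (h' : φ' ∈ radHom k Y Z j) : φ ≫ φ' ∈ radHom k X Z n := by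
  subst e
  obtain ⟨ψ, rfl⟩ := mem_radHom.1 h
  obtain ⟨ψ', rfl⟩ := mem_radHom.1 h'
  obtain ⟨χ, hχ⟩ := radPow_functorial j ψ' i
  exact mem_radHom.2 ⟨ψ ≫ χ, by rw [Category.assoc, hχ, Category.assoc]⟩

variable (k)

/-- The degree `i` part `Hom(X, Y)ⁱ / Hom(X, Y)ⁱ⁺¹` of the space of maps in `gr A`. -/
abbrev grPart (X Y : A) (i : ℕ) :=
  radHom k X Y i ⧸ (radHom k X Y (i + 1)).submoduleOf (radHom k X Y i)

/-- The graded vector space associated to the filtration of `Hom(X, Y)`. -/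
abbrev GHom (X Y : A) := DirectSum ℕ (fun i => grPart k X Y i)

variable {k}

/-- The composition of homogeneous maps of degrees `i` and `j` in `gr A`. -/
noncomputable def grCompPart (X Y Z : A) (i j n : ℕ) (e : j + i = n) :
    grPart k X Y i →ₗ[k] grPart k Y Z j →ₗ[k] grPart k X Z n :=
  let c : radHom k X Y i →ₗ[k] radHom k Y Z j →ₗ[k] grPart k X Z n :=
    LinearMap.mk₂ k
      (fun φ φ' => Submodule.Quotient.mk ⟨φ.1 ≫ φ'.1, comp_mem_radHom e φ.2 φ'.2⟩)
      (fun φ₁ φ₂ φ' => by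
        rw [← Submodule.Quotient.mk_add]
        exact congrArg _ (Subtype.ext (Preadditive.add_comp _ _ _ _ _ _)))
      (fun c φ φ' => by
        rw [← Submodule.Quotient.mk_smul]
        exact congrArg _ (Subtype.ext (Linear.smul_comp _ _ _ _ _ _)))
      (fun φ φ₁ φ₂ => by
        rw [← Submodule.Quotient.mk_add]
        exact congrArg _ (Subtype.ext (Preadditive.comp_add _ _ _ _ _ _)))
      (fun c φ φ' => by
        rw [← Submodule.Quotient.mk_smul]
        exact congrArg _ (Subtype.ext (Linear.comp_smul _ _ _ _ _ _)))
  Submodule.liftQ _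
    (LinearMap.flip (Submodule.liftQ _ c.flip (fun φ' hφ' => by
      refine LinearMap.ext fun φ => (Submodule.Quotient.mk_eq_zero _).2 ?_
      exact comp_mem_radHom (by omega) φ.2 (show φ'.1 ∈ radHom k Y Z (j + 1) from hφ'))))
    (fun φ hφ => by
      refine LinearMap.ext fun y => ?_
      induction y using Submodule.Quotient.induction_on with
      | _ φ' =>
      refine (Submodule.Quotient.mk_eq_zero _).2 ?_
      exact comp_mem_radHom (by omega) (show φ.1 ∈ radHom k X Y (i + 1) from hφ) φ'.2)

/-- The class in degree `i` of a map `φ` whose image is contained in `radⁱ Y`. -/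
noncomputable def grMk {X Y : A} (i : ℕ) (φ : X ⟶ Y) (h : φ ∈ radHom k X Y i) : GHom k X Y :=
  DirectSum.lof k ℕ (fun i => grPart k X Y i) i (Submodule.Quotient.mk ⟨φ, h⟩)

/-- The composition of maps in `gr A`. -/
noncomputable def grComp (X Y Z : A) : GHom k X Y →ₗ[k] GHom k Y Z →ₗ[k] GHom k X Z :=
  DirectSum.toModule k ℕ _ fun i => LinearMap.flip <| DirectSum.toModule k ℕ _ fun j =>
    LinearMap.flip <| (grCompPart X Y Z i j (j + i) rfl).compr₂
      (DirectSum.lof k ℕ (fun n => grPart k X Z n) (j + i))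

lemma grComp_mk {X Y Z : A} (i j n : ℕ) (e : j + i = n) {φ : X ⟶ Y} {φ' : Y ⟶ Z}
    (h : φ ∈ radHom k X Y i) (h' : φ' ∈ radHom k Y Z j) :
    grComp X Y Z (grMk i φ h) (grMk j φ' h') =
      grMk n (φ ≫ φ') (comp_mem_radHom e h h') := by
  subst e
  simp only [grComp, grMk, DirectSum.toModule_lof, LinearMap.flip_apply, LinearMap.compr₂_apply]
  rfl

lemma gHom_induction {X Y : A} {p : GHom k X Y → Prop} (x : GHom k X Y) (h0 : p 0)
    (hmk : ∀ i φ h, p (grMk i φ h)) (hadd : ∀ x y, p x → p y → p (x + y)) : p x := by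
  induction x using DirectSum.induction_on with
  | zero => exact h0
  | add x x' h h' => exact hadd _ _ h h'
  | of i g =>
    induction g using Submodule.Quotient.induction_on with
    | _ φ => exact hmk i φ.1 φ.2

/-- The identity maps are in degree `0`. -/
lemma id_mem_radHom (X : A) : 𝟙 X ∈ radHom k X X 0 := mem_radHom.2 ⟨𝟙 X, Category.id_comp _⟩

lemma grId_comp {X Y : A} (y : GHom k X Y) :
    grComp X X Y (grMk 0 (𝟙 X) (id_mem_radHom X)) y = y := by
  induction y using gHom_induction with
  | h0 => exact map_zero _
  | hadd x y hx hy => rw [map_add, hx, hy]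
  | hmk i φ h =>
    rw [grComp_mk 0 i i rfl]
    simp only [Category.id_comp]

lemma grComp_id {X Y : A} (x : GHom k X Y) :
    grComp X Y Y x (grMk 0 (𝟙 Y) (id_mem_radHom Y)) = x := by
  induction x using gHom_induction with
  | h0 => simp
  | hadd x y hx hy => rw [map_add, LinearMap.add_apply, hx, hy]
  | hmk i φ h =>
    rw [grComp_mk i 0 i (zero_add i)]
    simp only [Category.comp_id]

lemma grComp_assoc {X Y Z W : A} (x : GHom k X Y) (y : GHom k Y Z) (z : GHom k Z W) :
    grComp X Z W (grComp X Y Z x y) z = grComp X Y W x (grComp Y Z W y z) := by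
  induction x using gHom_induction with
  | h0 => simp
  | hadd x x' h h' => simp only [map_add, LinearMap.add_apply, h, h']
  | hmk i φ hφ =>
  induction y using gHom_induction with
  | h0 => simp
  | hadd x x' h h' => simp only [map_add, LinearMap.add_apply, h, h']
  | hmk j φ' hφ' =>
  induction z using gHom_induction with
  | h0 => simp
  | hadd x x' h h' => simp only [map_add, h, h']
  | hmk l φ'' hφ'' =>
  rw [grComp_mk i j (j + i) rfl, grComp_mk j l (l + j) rfl,
    grComp_mk (j + i) l (l + (j + i)) rfl, grComp_mk i (l + j) (l + (j + i)) (by omega)]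
  simp only [Category.assoc]

/-- The objects of the category `gr A`: they are the objects of `A` (the field `k` is recorded for
the `k`-linear structure). -/
@[nolint unusedArguments]
structure Gr (k : Type t) [Field k] (A : Type u) [Category.{v} A] [Abelian A] [Linear k A] where
  /-- the underlying object of `A` -/
  obj : A

noncomputable instance : Category (Gr k A) where
  Hom X Y := GHom k X.obj Y.obj
  id X := grMk 0 (𝟙 X.obj) (id_mem_radHom X.obj)
  comp {X Y Z} x y := grComp X.obj Y.obj Z.obj x y
  id_comp y := grId_comp y
  comp_id x := grComp_id x
  assoc x y z := grComp_assoc x y z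

noncomputable instance : Preadditive (Gr k A) where
  homGroup X Y := inferInstanceAs (AddCommGroup (GHom k X.obj Y.obj))
  add_comp X Y Z x x' y := (grComp X.obj Y.obj Z.obj).map_add₂ x x' y
  comp_add X Y Z x y y' := (grComp X.obj Y.obj Z.obj x).map_add y y'

noncomputable instance : Linear k (Gr k A) where
  homModule X Y := inferInstanceAs (Module k (GHom k X.obj Y.obj))
  smul_comp X Y Z c x y := (grComp X.obj Y.obj Z.obj).map_smul₂ c x y
  comp_smul X Y Z x c y := (grComp X.obj Y.obj Z.obj x).map_smul c y

end Radical

/-! ### The canonical functor -/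

section Canonical

/-- The shift functors of a triangulated subcategory of a `k`-linear triangulated category are
`k`-linear. -/
instance fullSubcategory_shift_linear (k : Type t) [Field k] {C : Type u} [Category.{v} C]
    [Preadditive C] [Linear k C] [HasShift C ℤ] [∀ n : ℤ, (shiftFunctor C n).Linear k]
    (P : ObjectProperty C) [P.IsStableUnderShift ℤ] (n : ℤ) :
    (shiftFunctor P.FullSubcategory n).Linear k where
  map_smul f r := by
    apply P.ι.map_injective
    rw [← cancel_mono ((P.ι.commShiftIso n).hom.app _), Functor.commShiftIso_hom_naturality,
      Functor.map_smul, Functor.map_smul, Functor.map_smul, Linear.smul_comp, Linear.comp_smul,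
      Functor.commShiftIso_hom_naturality]

variable {A : Type u} [Category.{v} A] [Abelian A] [HasDerivedCategory.{w} A]

variable (A) in
/-- The functor `A ⥤ Dᵇ(A)` that sends an object to the complex concentrated in degree `0`. -/
noncomputable def single : A ⥤ DerivedCategory.Bounded A :=
  ObjectProperty.lift _ (DerivedCategory.singleFunctor A 0) (fun X =>
    ⟨⟨0, inferInstanceAs (((DerivedCategory.singleFunctor A 0).obj X).IsGE 0)⟩,
      ⟨0, inferInstanceAs (((DerivedCategory.singleFunctor A 0).obj X).IsLE 0)⟩⟩)

/-- A set of objects of `A`, seen as a class of objects of `Dᵇ(A)`. -/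
def singleImage (𝒮 : Set A) : ObjectProperty (DerivedCategory.Bounded A) :=
  fun Z => ∃ X ∈ 𝒮, Z = (single A).obj X

variable [∀ X : A, IsArtinianObject X]

/-- The diagram `⋯ ⟶ rad² X ⟶ rad X ⟶ X ⟶ X / rad X` in `Dᵇ(A)`. -/
noncomputable def radDiagram (X : A) : Diagram (DerivedCategory.Bounded A) where
  M i := (single A).obj (radPow X i)
  f i := (single A).map (radIncl X i)
  N₀ := (single A).obj (cokernel (radIncl X 0))
  ε₀ := (single A).map (cokernel.π (radIncl X 0))

/-- The data of the canonical functor `gr A ⥤ ℱ`: it sends an object `X` to the diagram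
`⋯ ⟶ rad² X ⟶ rad X ⟶ X ⟶ X / rad X`, and it sends the class in degree `i` of a map `X ⟶ Y` that
factors as `ψ : X ⟶ radⁱ Y` followed by the inclusion to the map of degree `i` that is given by the
map `g : N₀ ⟶ N'ᵢ` induced by `ψ`. -/
structure CanonicalFunctor (k : Type t) [Field k] [Linear k A] (𝒮 : Set A) where
  /-- the diagrams `⋯ ⟶ rad² X ⟶ rad X ⟶ X ⟶ X / rad X` are objects of `ℱ` -/
  isFiltered : ∀ X : A, (radDiagram X).IsFiltered (singleImage 𝒮)
  /-- the action on maps -/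
  map : ∀ X Y : A, GHom k X Y →ₗ[k] DHom k (radDiagram X) (radDiagram Y)
  map_grMk : ∀ (X Y : A) (i : ℕ) (ψ : X ⟶ radPow Y i),
    ∃ (g : (radDiagram X).N 0 ⟶ (radDiagram Y).N i)
      (e : (single A).map ψ ≫ (radDiagram Y).ε i = (radDiagram X).ε 0 ≫ g),
      map X Y (grMk i (ψ ≫ radPowι Y i) (mem_radHom.2 ⟨ψ, rfl⟩)) =
        DirectSum.lof k ℕ (fun i => homPart k (radDiagram X) (radDiagram Y) i) i
          ⟨g, (single A).map ψ, e⟩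
  map_id : ∀ X : A, map X X (grMk 0 (𝟙 X) (id_mem_radHom X)) = dId (radDiagram X)
  map_comp : ∀ (X Y Z : A) (x : GHom k X Y) (y : GHom k Y Z),
    map X Z (grComp X Y Z x y) =
      dComp (radDiagram X) (isFiltered Y) (isFiltered Z) (map X Y x) (map Y Z y)

/-- The canonical functor `gr A ⥤ ℱ`. -/
noncomputable def CanonicalFunctor.toFunctor {k : Type t} [Field k] [Linear k A] {𝒮 : Set A}
    (Φ : CanonicalFunctor k 𝒮) : Gr k A ⥤ FilteredObject k (singleImage 𝒮) where
  obj X := ⟨radDiagram X.obj, Φ.isFiltered X.obj⟩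
  map {X Y} x := Φ.map X.obj Y.obj x
  map_id X := Φ.map_id X.obj
  map_comp {X Y Z} x y := Φ.map_comp X.obj Y.obj Z.obj x y

end Canonical

end RadicalGraded

namespace RadicalGraded

/-! ### Semisimple quotients and the radical. -/

section Semisimple

attribute [local instance] Abelian.hasFiniteBiproducts

variable {A : Type u} [Category.{v} A] [Abelian A] {𝒮 : Set A}

/-! The embedding `single` of the heart is fully faithful, so both categories can be compared inside
`A`. In the radical diagram of `X` the cone `Nᵢ` is `radⁱ X / radⁱ⁺¹ X`. It is semisimple because an
artinian object has a largest semisimple quotient, and this quotient is `X / rad X`; the filtration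
ends because a nonzero noetherian object differs from its radical. Hence radical diagrams are
filtered (`radDiagram_isFiltered`).

Fully faithful: a map `ψ : X ⟶ radⁱ Y` induces a unique `g` with `ε₀ ≫ g = ψ ≫ εᵢ`. It vanishes
exactly when `ψ` lands in `radⁱ⁺¹ Y` (`ker_toHomPart`), and by fullness every map of degree `i` in
`ℱ` arises in this way (`toHomPart_surjective`). Composites agree because the ladder on such a `g`
can be taken to consist of restrictions of `ψ` to the radical powers (`ladder_h_eq`,
`compPart_toHomPart`). The prescribed values on homogeneous classes determine the functor
(`CanonicalFunctor.map_eq`), so these facts apply to every `Φ`.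

Essentially surjective: the `Mᵢ` of a filtered object vanish for large `i` and are successive
extensions of the `Nᵢ`, so they lie in the heart (`Diagram.IsFiltered.essImage`). Then `ε₀` is an
epimorphism `X ⟶ Y` of `A` onto a semisimple object through which all maps to simple objects factor,
so its kernel is `rad X`. Matching `M₀ ⟶ N₀` suffices, because isomorphisms of degree `0` in `ℱ`
involve only this map (`FilteredObject.nonempty_iso`). -/

lemma radical_comp_eq_zero_of_addClosure (h_simple : ∀ S ∈ 𝒮, Simple S) {X Y : A}
    [IsArtinianObject X] (hY : AddClosure (fun S => S ∈ 𝒮) Y) (p : X ⟶ Y) :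
    (radical X).arrow ≫ p = 0 := by
  obtain ⟨n, F, b, hF, ⟨hb⟩, ⟨e⟩⟩ := hY
  rw [← cancel_mono e.hom, zero_comp]
  refine hb.isLimit.hom_ext fun ⟨j⟩ => ?_
  have := h_simple _ (hF j)
  change (_ ≫ e.hom) ≫ b.π j = 0 ≫ b.π j
  rw [zero_comp, Category.assoc, Category.assoc]
  exact radical_comp_eq_zero (p ≫ e.hom ≫ b.π j)

/-- The quotient by a maximal proper subobject is simple, hence isomorphic to a member of `𝒮`. So
`w` dies in every such quotient, and its image lies in every maximal subobject. -/
lemma radical_factors_of_comp_eq_zero (h_rep : ∀ X : A, Simple X → ∃ S ∈ 𝒮, Nonempty (X ≅ S))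
    {W X : A} [IsArtinianObject X] (w : W ⟶ X)
    (h : ∀ S ∈ 𝒮, ∀ e : X ⟶ S, w ≫ e = 0) : (radical X).Factors w := by
  have hle : imageSubobject w ≤ radical X := by
    refine (radical_isGLB X).2 fun P hP => ?_
    obtain ⟨S, hS, ⟨i⟩⟩ := h_rep _ (simple_cokernel hP)
    have h0 : w ≫ cokernel.π P.arrow = 0 := by
      rw [← cancel_mono i.hom, zero_comp, Category.assoc]
      exact h S hS _
    exact imageSubobject_le _ (Abelian.monoLift P.arrow w h0) (Abelian.monoLift_comp _ _ _)
  refine Subobject.factors_of_le w hle ?_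
  have h := Subobject.factors_comp_arrow (P := imageSubobject w) (factorThruImageSubobject w)
  rwa [imageSubobject_arrow_comp] at h

/-- An epimorphism to a semisimple object through which all maps to simple objects factor is a
cokernel of the inclusion of the radical. -/
lemma exists_iso_cokernel_radical (h_simple : ∀ S ∈ 𝒮, Simple S)
    (h_rep : ∀ X : A, Simple X → ∃ S ∈ 𝒮, Nonempty (X ≅ S)) {X Y : A} [IsArtinianObject X]
    (hY : AddClosure (fun S => S ∈ 𝒮) Y) (p : X ⟶ Y) [Epi p]
    (hp : ∀ S ∈ 𝒮, ∀ e : X ⟶ S, ∃ r, p ≫ r = e) :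
    ∃ i : cokernel (radical X).arrow ≅ Y, cokernel.π (radical X).arrow ≫ i.hom = p := by
  -- Every map from `X` to a member of `𝒮` factors through `p`, so it kills `ker p`. Conversely `p`
  -- kills the radical, and the two induced maps are mutually inverse.
  have hfac : (radical X).Factors (kernel.ι p) := by
    refine radical_factors_of_comp_eq_zero h_rep _ fun S hS e => ?_
    obtain ⟨r, rfl⟩ := hp S hS e
    rw [kernel.condition_assoc, zero_comp]
  refine ⟨⟨cokernel.desc _ p (radical_comp_eq_zero_of_addClosure h_simple hY p),
    Abelian.epiDesc p (cokernel.π _) ?_, ?_, ?_⟩, ?_⟩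
  · rw [← Subobject.factorThru_arrow _ _ hfac, Category.assoc, cokernel.condition, comp_zero]
  · rw [← cancel_epi (cokernel.π _), cokernel.π_desc_assoc, Abelian.comp_epiDesc, Category.comp_id]
  · rw [← cancel_epi p, ← Category.assoc, Abelian.comp_epiDesc, cokernel.π_desc, Category.comp_id]
  · exact cokernel.π_desc _ _ _

/-- Adjoining one simple summand: the new component is already epi on `ker p`, being nonzero there
with simple target. A map killed by `q` thus vanishes on the summand `G 0`, and then on the others
because `p` is epi. -/
lemma epi_of_epi_tail {X : A} {n : ℕ} {G : Fin (n + 1) → A} [Simple (G 0)] (q : X ⟶ ⨁ G)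
    (p : X ⟶ ⨁ fun j : Fin n => G j.succ) [Epi p]
    (hp : ∀ j, p ≫ biproduct.π (fun j : Fin n => G j.succ) j = q ≫ biproduct.π G j.succ)
    (he : kernel.ι p ≫ q ≫ biproduct.π G 0 ≠ 0) : Epi q := by
  have : Epi (kernel.ι p ≫ q ≫ biproduct.π G 0) := epi_of_nonzero_to_simple he
  refine Preadditive.epi_of_cancel_zero _ fun {W} t ht => ?_
  let t₁ : (⨁ fun j : Fin n => G j.succ) ⟶ W := biproduct.desc fun j => biproduct.ι G j.succ ≫ t
  have h1 : (q ≫ biproduct.π G 0) ≫ biproduct.ι G 0 ≫ t + p ≫ t₁ = 0 := by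
    rw [← ht]
    conv_rhs => rw [← Category.id_comp t, ← biproduct.total]
    rw [Fin.sum_univ_succ, Preadditive.add_comp, Preadditive.comp_add]
    simp only [t₁, biproduct.desc_eq, Preadditive.comp_sum, Preadditive.sum_comp, Category.assoc]
    congr 1
    refine Finset.sum_congr rfl fun j _ => ?_
    rw [← Category.assoc p, hp, Category.assoc]
  have h2 : biproduct.ι G 0 ≫ t = 0 := by
    have h := congrArg (kernel.ι p ≫ ·) h1
    simp only [Preadditive.comp_add, kernel.condition_assoc, zero_comp, add_zero, comp_zero] at h
    rw [← Category.assoc] at h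
    exact (cancel_epi (kernel.ι p ≫ q ≫ biproduct.π G 0)).1 (h.trans comp_zero.symm)
  have h3 : t₁ = 0 := by
    rw [h2, comp_zero, zero_add] at h1
    exact (cancel_epi p).1 (h1.trans comp_zero.symm)
  refine biproduct.hom_ext' _ _ fun j => ?_
  rw [comp_zero]
  induction j using Fin.cases with
  | zero => exact h2
  | succ j =>
    have h := congrArg (biproduct.ι (fun j : Fin n => G j.succ) j ≫ ·) h3
    simpa [t₁] using h

/-- Every artinian object has a largest semisimple quotient. -/
lemma exists_epi_addClosure (h_simple : ∀ S ∈ 𝒮, Simple S) (X : A) [IsArtinianObject X] :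
    ∃ (Y : A) (p : X ⟶ Y), Epi p ∧ AddClosure (fun S => S ∈ 𝒮) Y ∧
      ∀ S ∈ 𝒮, ∀ e : X ⟶ S, ∃ r, p ≫ r = e := by
  -- Kernels of epimorphisms to finite sums of members of `𝒮`. A minimal one exists since `X` is
  -- artinian. If some `e` did not factor through the corresponding `p`, adjoining `e` as a
  -- component would give a strictly smaller kernel.
  let s : Set (Subobject X) :=
    { R | ∃ (n : ℕ) (F : Fin n → A) (p : X ⟶ ⨁ F), (∀ j, F j ∈ 𝒮) ∧ Epi p ∧
      kernelSubobject p = R }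
  have hs : s.Nonempty := by
    refine ⟨_, 0, Fin.elim0, 0, fun j => j.elim0, ?_, rfl⟩
    refine Preadditive.epi_of_cancel_zero _ fun t _ => ?_
    exact biproduct.hom_ext' _ _ fun j => j.elim0
  obtain ⟨R, ⟨n, F, p, hF, hp, rfl⟩, hmin⟩ := WellFounded.has_min (r := (· < ·))
    (wellFounded_lt (α := Subobject X)) s hs
  refine ⟨⨁ F, p, hp, ⟨n, F, biproduct.bicone F, hF, ⟨biproduct.isBilimit F⟩, ⟨Iso.refl _⟩⟩,
    fun S hS e => ?_⟩
  by_contra hc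
  have := h_simple S hS
  have he : kernel.ι p ≫ e ≠ 0 := fun h0 =>
    hc ⟨Abelian.epiDesc p e h0, Abelian.comp_epiDesc _ _ _⟩
  -- Treating `S` and `F` as head and tail of one family avoids casts between the summands.
  obtain ⟨G, rfl, rfl⟩ : ∃ G : Fin (n + 1) → A, G 0 = S ∧ (fun j => G j.succ) = F :=
    ⟨Fin.cons S F, rfl, rfl⟩
  let q : X ⟶ ⨁ G := biproduct.lift (Fin.cases e fun j => p ≫ biproduct.π _ j)
  have hq0 : q ≫ biproduct.π G 0 = e := biproduct.lift_π _ _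
  have hqp (j : Fin n) : q ≫ biproduct.π G j.succ = p ≫ biproduct.π (fun j => G j.succ) j :=
    biproduct.lift_π _ _
  refine hmin (kernelSubobject q) ⟨n + 1, G, q, Fin.cases hS hF, ?_, rfl⟩ ?_
  · refine epi_of_epi_tail q p (fun j => (hqp j).symm) ?_
    rwa [hq0]
  · refine lt_of_le_of_ne (le_kernelSubobject _ _ ?_) fun h => he ?_
    · refine biproduct.hom_ext _ _ fun j => ?_
      rw [Category.assoc, ← hqp, kernelSubobject_arrow_comp_assoc, zero_comp, zero_comp]
    · have h0 : (kernelSubobject p).arrow ≫ e = 0 := by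
        rw [← h, ← hq0, kernelSubobject_arrow_comp_assoc, zero_comp]
      rw [← kernelSubobject_arrow', Category.assoc, h0, comp_zero]

/-- The largest semisimple quotient from `exists_epi_addClosure` is a cokernel of the inclusion of
the radical. -/
lemma addClosure_cokernel_radical (h_simple : ∀ S ∈ 𝒮, Simple S)
    (h_rep : ∀ X : A, Simple X → ∃ S ∈ 𝒮, Nonempty (X ≅ S)) (X : A) [IsArtinianObject X] :
    AddClosure (fun S => S ∈ 𝒮) (cokernel (radical X).arrow) := by
  obtain ⟨Y, p, _, hY, hp⟩ := exists_epi_addClosure h_simple X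
  obtain ⟨i, -⟩ := exists_iso_cokernel_radical h_simple h_rep hY p hp
  obtain ⟨n, F, b, hF, hb, ⟨e⟩⟩ := hY
  exact ⟨n, F, b, hF, hb, ⟨i ≪≫ e⟩⟩

/-- A form of Nakayama's lemma: a nonzero noetherian object has a maximal proper subobject, which
contains the radical. -/
lemma isZero_of_isIso_radical_arrow (X : A) [IsArtinianObject X] [IsNoetherianObject X]
    [IsIso (radical X).arrow] : IsZero X := by
  by_contra hX
  have : Nontrivial (Subobject X) := Subobject.nontrivial_of_not_isZero hX
  obtain ⟨P, hP, -⟩ := (IsCoatomic.eq_top_or_exists_le_coatom (⊥ : Subobject X)).resolve_left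
    bot_ne_top
  have h := (radical_isGLB X).1 hP
  rw [Subobject.eq_top_of_isIso_arrow (radical X)] at h
  exact hP.1 (top_unique h)

end Semisimple

/-! ### Finiteness of the radical filtration. -/

section RadicalPowers

variable {A : Type u} [Category.{v} A] [Abelian A] [∀ X : A, IsArtinianObject X]

instance (X : A) (i : ℕ) : Mono (radIncl X i) :=
  inferInstanceAs (Mono (radical (radPow X i)).arrow)

instance (X : A) (i : ℕ) : Mono (radPowι X i) := by
  induction i with
  | zero => exact inferInstanceAs (Mono (𝟙 X))
  | succ i ih => exact inferInstanceAs (Mono (radIncl X i ≫ radPowι X i))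

/-- The radical filtration of an object of finite length is finite. -/
lemma exists_isZero_radPow [∀ X : A, IsNoetherianObject X] (X : A) :
    ∃ n, ∀ i ≥ n, IsZero (radPow X i) := by
  have hanti : Antitone fun i => Subobject.mk (radPowι X i) := antitone_nat_of_succ_le fun i =>
    Subobject.mk_le_mk_of_comm (radIncl X i) rfl
  obtain ⟨n, hn⟩ := antitone_chain_condition_of_isArtinianObject
    (X := X) ⟨fun i => OrderDual.toDual (Subobject.mk (radPowι X i)), fun i j h => hanti h⟩
  have hn1 : Subobject.mk (radPowι X n) = Subobject.mk (radPowι X (n + 1)) := hn (n + 1) n.le_succ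
  -- Where the chain stabilises, the inclusion `radⁿ⁺¹ X ⟶ radⁿ X` is a split epimorphism, hence an
  -- isomorphism, and `radⁿ X` is zero by Nakayama.
  have h1 : Subobject.ofMkLEMk _ _ hn1.le ≫ radIncl X n = 𝟙 _ := by
    rw [← cancel_mono (radPowι X n), Category.assoc, Category.id_comp]
    exact Subobject.ofMkLEMk_comp hn1.le
  have : IsSplitEpi (radIncl X n) := ⟨⟨⟨_, h1⟩⟩⟩
  have : IsIso (radIncl X n) := isIso_of_mono_of_epi _
  have : IsIso (radical (radPow X n)).arrow := this
  have h0 : IsZero (radPow X n) := isZero_of_isIso_radical_arrow _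
  refine ⟨n, fun i hi => ?_⟩
  induction i, hi using Nat.le_induction with
  | base => exact h0
  | succ i hi ih => exact IsZero.of_mono (radIncl X i) ih

end RadicalPowers

/-! ### The heart of the bounded derived category. -/

section BoundedDerived

variable {A : Type u} [Category.{v} A] [Abelian A] [HasDerivedCategory.{w} A]

instance : (single A).Full :=
  Functor.Full.of_comp_faithful_iso (G := DerivedCategory.Bounded.ι)
    (ObjectProperty.liftCompιIso _ (DerivedCategory.singleFunctor A 0) _)

instance : (single A).Faithful :=
  Functor.Faithful.of_comp_iso (G := DerivedCategory.Bounded.ι)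
    (ObjectProperty.liftCompιIso _ (DerivedCategory.singleFunctor A 0) _)

instance : (single A).Additive where
  map_add {X Y f g} := by
    apply (DerivedCategory.Bounded.ι (C := A)).map_injective
    exact (DerivedCategory.singleFunctor A 0).map_add

/-- A short exact sequence in `A` gives a distinguished triangle in `Dᵇ(A)`. -/
lemma exists_distinguished_of_shortExact {S : ShortComplex A} (hS : S.ShortExact) :
    ∃ δ, Triangle.mk ((single A).map S.f) ((single A).map S.g) δ ∈
      distTriang (DerivedCategory.Bounded A) := by
  let ι := DerivedCategory.Bounded.ι (C := A)
  let s : ι.obj ((single A).obj S.X₃) ⟶ (ι.obj ((single A).obj S.X₁))⟦(1 : ℤ)⟧ := hS.singleδ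
  -- The connecting map lives in the unbounded derived category; it descends by fullness of `ι`,
  -- after correcting for the comparison of the two shifts.
  obtain ⟨δ, hδ⟩ := ι.map_surjective (s ≫ (ι.commShiftIso (1 : ℤ)).inv.app _)
  refine ⟨δ, (ι.map_distinguished_iff _).1 (isomorphic_distinguished _
    hS.singleTriangle_distinguished _ (Triangle.isoMk _ _ (Iso.refl _) (Iso.refl _) (Iso.refl _)
      ?_ ?_ ?_))⟩
  · exact (Category.comp_id _).trans (Category.id_comp _).symm
  · exact (Category.comp_id _).trans (Category.id_comp _).symm
  · have h : ι.map δ ≫ (ι.commShiftIso (1 : ℤ)).hom.app _ = s := by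
      rw [hδ, Category.assoc, Iso.inv_hom_id_app]
      exact Category.comp_id _
    change (ι.map δ ≫ (ι.commShiftIso (1 : ℤ)).hom.app _) ≫
      (𝟙 (ι.obj ((single A).obj S.X₁)))⟦(1 : ℤ)⟧' = 𝟙 _ ≫ s
    rw [h, CategoryTheory.Functor.map_id]
    exact (Category.comp_id s).trans (Category.id_comp s).symm

/-- An object of `Dᵇ(A)` is in the heart if it is an extension of objects in the heart. -/
lemma single_essImage_of_distinguished {M₁ M₀ N : DerivedCategory.Bounded A} {f : M₁ ⟶ M₀}
    {g : M₀ ⟶ N} {δ} (hT : Triangle.mk f g δ ∈ distTriang _) (h₁ : (single A).essImage M₁)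
    (h₃ : (single A).essImage N) : (single A).essImage M₀ := by
  let ι := DerivedCategory.Bounded.ι (C := A)
  obtain ⟨X, ⟨e₁⟩⟩ := h₁
  obtain ⟨Y, ⟨e₃⟩⟩ := h₃
  have hT' := ι.map_distinguished _ hT
  have le (Z : A) : (ι.obj ((single A).obj Z)).IsLE 0 :=
    inferInstanceAs (((DerivedCategory.singleFunctor A 0).obj Z).IsLE 0)
  have ge (Z : A) : (ι.obj ((single A).obj Z)).IsGE 0 :=
    inferInstanceAs (((DerivedCategory.singleFunctor A 0).obj Z).IsGE 0)
  -- Both halves of the standard t-structure are closed under extensions, and an object in both at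
  -- `0` is a single complex.
  let t := DerivedCategory.TStructure.t (C := A)
  have : (ι.obj M₀).IsLE 0 := t.isLE₂ _ hT' 0 (t.isLE_of_iso (ι.mapIso e₁) 0)
    (t.isLE_of_iso (ι.mapIso e₃) 0)
  have : (ι.obj M₀).IsGE 0 := t.isGE₂ _ hT' 0 (t.isGE_of_iso (ι.mapIso e₁) 0)
    (t.isGE_of_iso (ι.mapIso e₃) 0)
  obtain ⟨Z, ⟨e⟩⟩ := (ι.obj M₀).exists_iso_singleFunctor_obj_of_isGE_of_isLE 0
  exact ⟨Z, ⟨(ι.preimageIso (X := M₀) (Y := (single A).obj Z) e).symm⟩⟩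

/-- There are no nonzero maps of degree `-1` between objects of the heart. -/
lemma shift_single_hom_eq_zero {X Y : A}
    (φ : ((single A).obj X)⟦(1 : ℤ)⟧ ⟶ (single A).obj Y) : φ = 0 := by
  let ι := DerivedCategory.Bounded.ι (C := A)
  let t := DerivedCategory.TStructure.t (C := A)
  have le : t.IsLE (ι.obj ((single A).obj X)) 0 :=
    inferInstanceAs (((DerivedCategory.singleFunctor A 0).obj X).IsLE 0)
  have ge : t.IsGE (ι.obj ((single A).obj Y)) 0 :=
    inferInstanceAs (((DerivedCategory.singleFunctor A 0).obj Y).IsGE 0)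
  -- The shifted source lies in degrees `≤ -1` and the target in degrees `≥ 0`; the next lines move
  -- this bound across `commShiftIso`.
  have := t.isLE_shift (ι.obj ((single A).obj X)) 0 1 (-1)
  have : t.IsLE ((ι ⋙ shiftFunctor _ (1 : ℤ)).obj ((single A).obj X)) (-1) := this
  have : t.IsLE (ι.obj (((single A).obj X)⟦(1 : ℤ)⟧)) (-1) :=
    t.isLE_of_iso ((ι.commShiftIso (1 : ℤ)).symm.app _) (-1)
  apply ι.map_injective
  rw [Functor.map_zero]
  exact t.zero (ι.map φ) (-1) 0

/-- The last map of a distinguished triangle of objects of the heart is an epimorphism. -/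
lemma epi_of_distinguished {M₁ : DerivedCategory.Bounded A} {X Y : A}
    (h₁ : (single A).essImage M₁) {f : M₁ ⟶ (single A).obj X} {p : X ⟶ Y} {δ}
    (hT : Triangle.mk f ((single A).map p) δ ∈ distTriang _) : Epi p := by
  obtain ⟨X₁, ⟨e₁⟩⟩ := h₁
  refine Preadditive.epi_of_cancel_zero _ fun {W} t ht => ?_
  -- A map killed by `p` factors through `M₁⟦1⟧`, from which there are no nonzero maps to the heart.
  obtain ⟨φ, hφ⟩ := Triangle.yoneda_exact₃ _ hT ((single A).map t)
    (by change (single A).map p ≫ _ = 0; rw [← Functor.map_comp, ht, Functor.map_zero])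
  change M₁⟦(1 : ℤ)⟧ ⟶ _ at φ
  have h0 : φ = 0 := by
    rw [← cancel_epi (e₁.hom⟦(1 : ℤ)⟧')]
    exact (shift_single_hom_eq_zero _).trans comp_zero.symm
  apply (single A).map_injective
  rw [hφ, h0, Functor.map_zero]
  exact comp_zero

lemma addClosure_of_iso {T : Type*} [Category T] [Preadditive T] {S : ObjectProperty T} {X Y : T}
    (e : X ≅ Y) (hX : AddClosure S X) : AddClosure S Y := by
  obtain ⟨n, F, b, hF, hb, ⟨i⟩⟩ := hX
  exact ⟨n, F, b, hF, hb, ⟨e.symm ≪≫ i⟩⟩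

lemma addClosure_single {𝒮 : Set A} {Y : A} (hY : AddClosure (fun S => S ∈ 𝒮) Y) :
    AddClosure (singleImage 𝒮) ((single A).obj Y) := by
  obtain ⟨n, F, b, hF, ⟨hb⟩, ⟨e⟩⟩ := hY
  exact ⟨n, _, (single A).mapBicone b, fun j => ⟨F j, hF j, rfl⟩, ⟨isBilimitOfPreserves _ hb⟩,
    ⟨(single A).mapIso e⟩⟩

-- The additive functor `single` preserves biproducts, so a sum of images is the image of the sum
-- taken in `A`.
attribute [local instance] Abelian.hasFiniteBiproducts in
lemma exists_iso_single_of_addClosure {𝒮 : Set A} {Z : DerivedCategory.Bounded A}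
    (hZ : AddClosure (singleImage 𝒮) Z) :
    ∃ Y, AddClosure (fun S => S ∈ 𝒮) Y ∧ Nonempty (Z ≅ (single A).obj Y) := by
  obtain ⟨n, F, b, hF, ⟨hb⟩, ⟨e⟩⟩ := hZ
  choose G hG hFG using hF
  obtain rfl : F = (single A).obj ∘ G := funext hFG
  have h := isBilimitOfPreserves (single A) (biproduct.isBilimit G)
  exact ⟨⨁ G, ⟨n, G, biproduct.bicone G, hG, ⟨biproduct.isBilimit G⟩, ⟨Iso.refl _⟩⟩,
    ⟨e ≪≫ hb.isLimit.conePointUniqueUpToIso h.isLimit⟩⟩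

end BoundedDerived

/-! ### Radical diagrams as filtered objects. -/

section RadicalDiagram

variable {A : Type u} [Category.{v} A] [Abelian A] [HasDerivedCategory.{w} A]
  [∀ X : A, IsArtinianObject X]

/-- The map `radⁱ X ⟶ Nᵢ` in the radical diagram. -/
noncomputable abbrev radε (X : A) (i : ℕ) : (single A).obj (radPow X i) ⟶ (radDiagram X).N i :=
  (radDiagram X).ε i

lemma exists_distinguished_radIncl (X : A) (i : ℕ) :
    ∃ δ, Triangle.mk ((single A).map (radIncl X i))
      ((single A).map (cokernel.π (radIncl X i))) δ ∈ distTriang (DerivedCategory.Bounded A) :=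
  exists_distinguished_of_shortExact (S := ShortComplex.mk _ _ (cokernel.condition (radIncl X i)))
    { exact := ShortComplex.exact_cokernel _ }

/-- For `i ≥ 1` the object `Nᵢ` is an arbitrarily chosen cone; uniqueness of cones, compatibly with
the maps into them, identifies it with a cokernel in `A`. -/
lemma exists_iso_cone {T : Type*} [Category T] [Preadditive T] [HasZeroObject T] [HasShift T ℤ]
    [∀ n : ℤ, (shiftFunctor T n).Additive] [Pretriangulated T] {X Y Z Z' : T} {f : X ⟶ Y}
    {g : Y ⟶ Z} {g' : Y ⟶ Z'} {δ δ'} (h : Triangle.mk f g δ ∈ distTriang T)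
    (h' : Triangle.mk f g' δ' ∈ distTriang T) : ∃ e : Z ≅ Z', g ≫ e.hom = g' := by
  obtain ⟨e, -, h₂⟩ := exists_iso_of_arrow_iso _ _ h h' (Iso.refl _)
  refine ⟨Triangle.π₃.mapIso e, ?_⟩
  have := e.hom.comm₂
  rw [h₂] at this
  exact this.trans (Category.id_comp _)

/-- The object `Nᵢ` of the radical diagram is `radⁱ X / radⁱ⁺¹ X`. -/
lemma exists_iso_radDiagram_N (X : A) (i : ℕ) :
    ∃ e : (radDiagram X).N i ≅ (single A).obj (cokernel (radIncl X i)),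
      radε X i ≫ e.hom = (single A).map (cokernel.π (radIncl X i)) := by
  cases i with
  | zero => exact ⟨Iso.refl _, Category.comp_id _⟩
  | succ i =>
    exact exists_iso_cone
      (distinguished_cocone_triangle ((radDiagram X).f (i + 1))).choose_spec.choose_spec.choose_spec
      (exists_distinguished_radIncl X (i + 1)).choose_spec

/-- Full faithfulness of `single` reduces this to the universal property of the cokernel `radⁱ X /
radⁱ⁺¹ X`. With `Y` simple it yields both the surjectivity condition at `0` and the bijectivity
conditions above it. -/
lemma radDiagram_bijective (X Y : A) (i : ℕ) (h : ∀ e : radPow X i ⟶ Y, radIncl X i ≫ e = 0) :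
    Function.Bijective (fun r : (radDiagram X).N i ⟶ (single A).obj Y =>
      radε X i ≫ r) := by
  obtain ⟨e, he⟩ := exists_iso_radDiagram_N X i
  constructor
  · intro r r' hr
    rw [← cancel_epi e.inv]
    obtain ⟨s, hs⟩ := (single A).map_surjective (e.inv ≫ r)
    obtain ⟨s', hs'⟩ := (single A).map_surjective (e.inv ≫ r')
    rw [← hs, ← hs']
    congr 1
    rw [← cancel_epi (cokernel.π (radIncl X i))]
    apply (single A).map_injective
    rw [Functor.map_comp, Functor.map_comp, hs, hs', ← he]
    simpa only [Category.assoc, Iso.hom_inv_id_assoc] using hr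
  · intro φ
    obtain ⟨ψ, rfl⟩ := (single A).map_surjective φ
    refine ⟨e.hom ≫ (single A).map (cokernel.desc _ ψ (h ψ)), ?_⟩
    change radε X i ≫ e.hom ≫ _ = _
    rw [reassoc_of% he, ← Functor.map_comp, cokernel.π_desc]

/-- The radical diagrams are filtered objects. -/
lemma radDiagram_isFiltered [∀ X : A, IsNoetherianObject X] {𝒮 : Set A}
    (h_simple : ∀ S ∈ 𝒮, Simple S)
    (h_rep : ∀ X : A, Simple X → ∃ S ∈ 𝒮, Nonempty (X ≅ S)) (X : A) :
    (radDiagram X).IsFiltered (singleImage 𝒮) where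
  eventually_isZero := by
    obtain ⟨n, hn⟩ := exists_isZero_radPow X
    exact ⟨n, fun i hi => (single A).map_isZero (hn i hi)⟩
  isTriangle₀ := exists_distinguished_radIncl X 0
  add i := by
    obtain ⟨e, -⟩ := exists_iso_radDiagram_N X i
    exact addClosure_of_iso e.symm
      (addClosure_single (addClosure_cokernel_radical h_simple h_rep (radPow X i)))
  surjective₀ := by
    rintro _ ⟨S, hS, rfl⟩
    have := h_simple S hS
    exact (radDiagram_bijective X S 0 fun e => radical_comp_eq_zero e).2
  bijective := by
    rintro i _ ⟨S, hS, rfl⟩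
    have := h_simple S hS
    exact radDiagram_bijective X S (i + 1) fun e => radical_comp_eq_zero e

/-- A map from `Nᵢ` to `Nⱼ` between radical diagrams is determined by its composition with `ε`. -/
lemma radDiagram_hom_ext {X Y : A} {i j : ℕ} {g g' : (radDiagram X).N i ⟶ (radDiagram Y).N j}
    (h : radε X i ≫ g = radε X i ≫ g') : g = g' := by
  obtain ⟨e, he⟩ := exists_iso_radDiagram_N X i
  obtain ⟨e', he'⟩ := exists_iso_radDiagram_N Y j
  rw [← cancel_epi e.inv, ← cancel_mono e'.hom]
  -- `ε` need not be epi in `Dᵇ(A)`. Since both ends lie in the heart, the comparison moves to `A`,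
  -- where the cokernel projection is epi.
  obtain ⟨s, hs⟩ := (single A).map_surjective ((e.inv ≫ g) ≫ e'.hom)
  obtain ⟨s', hs'⟩ := (single A).map_surjective ((e.inv ≫ g') ≫ e'.hom)
  rw [← hs, ← hs']
  congr 1
  rw [← cancel_epi (cokernel.π (radIncl X i))]
  apply (single A).map_injective
  rw [Functor.map_comp, Functor.map_comp, hs, hs', ← he]
  simp only [Category.assoc, Iso.hom_inv_id_assoc, reassoc_of% h]

end RadicalDiagram

/-! ### Lifting maps to radical powers. -/

section RadLift

variable {A : Type u} [Category.{v} A] [Abelian A] [∀ X : A, IsArtinianObject X]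
  {k : Type t} [Field k] [Linear k A]

/-- The map `X ⟶ radⁱ Y` induced by a map `X ⟶ Y` with image in `radⁱ Y`. -/
noncomputable def radLift {X Y : A} {i : ℕ} (φ : radHom k X Y i) : X ⟶ radPow Y i :=
  (mem_radHom.1 φ.2).choose

lemma radLift_comp {X Y : A} {i : ℕ} (φ : radHom k X Y i) : radLift φ ≫ radPowι Y i = φ.1 :=
  (mem_radHom.1 φ.2).choose_spec

/-- The inclusion of `radⁱ Y` is mono, so the lift is unique; this makes the chosen lift linear in
the map. -/
lemma eq_radLift {X Y : A} {i : ℕ} (φ : radHom k X Y i) {ψ : X ⟶ radPow Y i}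
    (h : ψ ≫ radPowι Y i = φ.1) : ψ = radLift φ := by
  rw [← cancel_mono (radPowι Y i), h, radLift_comp]

lemma radLift_add {X Y : A} {i : ℕ} (φ φ' : radHom k X Y i) :
    radLift (φ + φ') = radLift φ + radLift φ' :=
  (eq_radLift _ (by rw [Preadditive.add_comp, radLift_comp, radLift_comp]; rfl)).symm

lemma radLift_smul {X Y : A} {i : ℕ} (c : k) (φ : radHom k X Y i) :
    radLift (c • φ) = c • radLift φ :=
  (eq_radLift _ (by rw [Linear.smul_comp, radLift_comp]; rfl)).symm

end RadLift

/-! ### The canonical functor on maps, and its full faithfulness. -/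

section CanonicalMap

variable {A : Type u} [Category.{v} A] [Abelian A] [HasDerivedCategory.{w} A]
  {k : Type t} [Field k] [Linear k A]

instance : (single A).Linear k where
  map_smul f c := by
    apply (DerivedCategory.Bounded.ι (C := A)).map_injective
    exact (DerivedCategory.singleFunctor A 0).map_smul c f

variable [∀ X : A, IsArtinianObject X] {𝒮 : Set A}

/-- The map of degree `i` of filtered objects attached to a map with image in `radⁱ Y`. -/
noncomputable def toHomPart (hF : ∀ X : A, (radDiagram X).IsFiltered (singleImage 𝒮)) (X Y : A)
    (i : ℕ) : radHom k X Y i →ₗ[k] homPart k (radDiagram X) (radDiagram Y) i where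
  toFun φ := ⟨((hF X).exists_lift 0 ((hF Y).add i) ((single A).map (radLift φ) ≫ radε Y i)).choose,
    (single A).map (radLift φ),
    ((hF X).exists_lift 0 ((hF Y).add i) ((single A).map (radLift φ) ≫ radε Y i)).choose_spec.symm⟩
  map_add' φ φ' := by
    have h (φ : radHom k X Y i) := ((hF X).exists_lift 0 ((hF Y).add i)
      ((single A).map (radLift φ) ≫ radε Y i)).choose_spec
    -- The chosen `g` is determined by its composite with `ε₀`, so linearity can be checked after
    -- that composition.
    refine Subtype.ext (radDiagram_hom_ext ((h _).trans ?_))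
    have e : (single A).map (radLift (φ + φ')) ≫ radε Y i =
        (single A).map (radLift φ) ≫ radε Y i + (single A).map (radLift φ') ≫ radε Y i := by
      rw [radLift_add, Functor.map_add, Preadditive.add_comp]
    refine e.trans ?_
    refine (congrArg₂ (· + ·) (h φ) (h φ')).symm.trans ?_
    exact (Preadditive.comp_add _ _ _ _ _ _).symm
  map_smul' c φ := by
    have h (φ : radHom k X Y i) := ((hF X).exists_lift 0 ((hF Y).add i)
      ((single A).map (radLift φ) ≫ radε Y i)).choose_spec
    refine Subtype.ext (radDiagram_hom_ext ((h _).trans ?_))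
    have e : (single A).map (radLift (c • φ)) ≫ radε Y i =
        c • ((single A).map (radLift φ) ≫ radε Y i) := by
      rw [radLift_smul, Functor.map_smul, Linear.smul_comp]
    refine e.trans ?_
    refine (congrArg (c • ·) (h φ)).symm.trans ?_
    exact (Linear.comp_smul _ _ _ _ _ _).symm

variable (hF : ∀ X : A, (radDiagram X).IsFiltered (singleImage 𝒮))

lemma comp_toHomPart {X Y : A} {i : ℕ} (φ : radHom k X Y i) :
    radε X 0 ≫ (toHomPart hF X Y i φ).1 = (single A).map (radLift φ) ≫ radε Y i :=
  ((hF X).exists_lift 0 ((hF Y).add i) ((single A).map (radLift φ) ≫ radε Y i)).choose_spec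

lemma toHomPart_eq {X Y : A} {i : ℕ} {φ : radHom k X Y i} {ψ : X ⟶ radPow Y i}
    (h : ψ ≫ radPowι Y i = φ.1) {g : homPart k (radDiagram X) (radDiagram Y) i}
    (hg : radε X 0 ≫ g.1 = (single A).map ψ ≫ radε Y i) : toHomPart hF X Y i φ = g := by
  refine Subtype.ext (radDiagram_hom_ext ?_)
  rw [comp_toHomPart, ← eq_radLift φ h, hg]

/-- Up to isomorphism `radε Y i` is the cokernel projection of the monomorphism `radIncl Y i`, which
is in turn the kernel of that projection. -/
lemma single_comp_radε_eq_zero_iff {X Y : A} {i : ℕ} (ψ : X ⟶ radPow Y i) :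
    (single A).map ψ ≫ radε Y i = 0 ↔ ∃ χ, χ ≫ radIncl Y i = ψ := by
  obtain ⟨e, he⟩ := exists_iso_radDiagram_N Y i
  rw [← cancel_mono e.hom, zero_comp, Category.assoc, he, ← Functor.map_comp,
    Functor.map_eq_zero_iff]
  constructor
  · exact fun h => ⟨Abelian.monoLift _ ψ h, Abelian.monoLift_comp _ _ _⟩
  · rintro ⟨χ, rfl⟩
    rw [Category.assoc, cokernel.condition, comp_zero]

/-- Cancelling `ε₀`, the induced map vanishes exactly when the lift to `radⁱ Y` factors through
`radⁱ⁺¹ Y`. One inclusion makes `canonicalMap` well defined on the graded pieces, the other makes it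
injective. -/
lemma ker_toHomPart (X Y : A) (i : ℕ) :
    LinearMap.ker (toHomPart (k := k) hF X Y i) =
      (radHom k X Y (i + 1)).submoduleOf (radHom k X Y i) := by
  ext φ
  have h : φ ∈ LinearMap.ker (toHomPart hF X Y i) ↔
      (single A).map (radLift φ) ≫ radε Y i = 0 := by
    rw [LinearMap.mem_ker, ← comp_toHomPart hF]
    constructor
    · intro h
      rw [h]
      exact comp_zero
    · exact fun h => Subtype.ext (radDiagram_hom_ext (h.trans comp_zero.symm))
  rw [h, single_comp_radε_eq_zero_iff]
  constructor
  · rintro ⟨χ, hχ⟩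
    refine mem_radHom.2 ⟨χ, ?_⟩
    change χ ≫ radIncl Y i ≫ radPowι Y i = φ.1
    rw [← radLift_comp φ, ← hχ, Category.assoc]
  · intro hφ
    obtain ⟨χ, hχ⟩ := mem_radHom.1 (show φ.1 ∈ radHom k X Y (i + 1) from hφ)
    exact ⟨χ, eq_radLift φ (by rw [← hχ, Category.assoc]; rfl)⟩

/-- The lift `M₀ ⟶ M'ᵢ` required of a map in `ℱ` comes from `A`, because `single` is full. -/
lemma toHomPart_surjective (X Y : A) (i : ℕ) :
    Function.Surjective (toHomPart (k := k) hF X Y i) := by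
  rintro ⟨g, h, hg⟩
  obtain ⟨ψ, rfl⟩ : ∃ ψ : X ⟶ radPow Y i, (single A).map ψ = h := (single A).map_surjective h
  exact ⟨⟨ψ ≫ radPowι Y i, mem_radHom.2 ⟨ψ, rfl⟩⟩, toHomPart_eq hF rfl hg.symm⟩

/-- The canonical functor on maps. -/
noncomputable def canonicalMap (X Y : A) :
    GHom k X Y →ₗ[k] DHom k (radDiagram X) (radDiagram Y) :=
  DirectSum.lmap fun i => Submodule.liftQ _ (toHomPart hF X Y i) (ker_toHomPart hF X Y i).ge

lemma canonicalMap_grMk {X Y : A} {i : ℕ} {φ : X ⟶ Y} (h : φ ∈ radHom k X Y i) :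
    canonicalMap hF X Y (grMk i φ h) =
      DirectSum.lof k ℕ (fun i => homPart k (radDiagram X) (radDiagram Y) i) i
        (toHomPart hF X Y i ⟨φ, h⟩) := by
  rw [canonicalMap, grMk, DirectSum.lmap_lof]
  rfl

lemma canonicalMap_bijective (X Y : A) : Function.Bijective (canonicalMap (k := k) hF X Y) := by
  refine ⟨(DirectSum.lmap_injective _).2 fun i => ?_, (DirectSum.lmap_surjective _).2 fun i => ?_⟩
  · rw [← LinearMap.ker_eq_bot]
    exact Submodule.ker_liftQ_eq_bot _ _ _ (ker_toHomPart hF X Y i).le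
  · intro g
    obtain ⟨φ, rfl⟩ := toHomPart_surjective hF X Y i g
    exact ⟨Submodule.Quotient.mk φ, rfl⟩

/-- A ladder between radical diagrams whose first map comes from a map of `A` is induced by that
map. -/
lemma ladder_h_eq {Y Z : A} {j : ℕ} (L : Ladder (radDiagram Y) (radDiagram Z) j)
    (ψ : Y ⟶ radPow Z j) (hL : L.h 0 j rfl = (single A).map ψ) (a : ℕ) :
    ∃ χ : radPow Y a ⟶ radPow Z (j + a), L.h a (j + a) rfl = (single A).map χ ∧
      χ ≫ radPowι Z (j + a) = radPowι Y a ≫ ψ ≫ radPowι Z j := by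
  induction a with
  | zero => exact ⟨ψ, hL, (Category.id_comp _).symm⟩
  | succ a ih =>
    obtain ⟨χ, h, hχ⟩ := ih
    obtain ⟨χ', hχ'⟩ : ∃ χ' : radPow Y (a + 1) ⟶ radPow Z (j + a + 1),
      (single A).map χ' = L.h (a + 1) (j + a + 1) rfl := (single A).map_surjective _
    -- By fullness the next rung also comes from `A`, and the square `comm₁` forces it to be the
    -- restriction of the previous one.
    have hc : radIncl Y a ≫ χ = χ' ≫ radIncl Z (j + a) := by
      apply (single A).map_injective
      rw [Functor.map_comp, Functor.map_comp, hχ', ← h]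
      exact L.comm₁ a (j + a) rfl
    refine ⟨χ', hχ'.symm, ?_⟩
    change χ' ≫ radIncl Z (j + a) ≫ radPowι Z (j + a) = (radIncl Y a ≫ radPowι Y a) ≫ _
    rw [← Category.assoc χ', ← hc, Category.assoc, hχ, Category.assoc]

/-- Composition in `ℱ` uses a chosen ladder, but its maps on the `Nₐ` depend only on the first. So
the ladder may be replaced by one starting with the lift of `φ'`, whose rung at `i` is the
restriction of `φ'` to `radⁱ Y`. -/
lemma compPart_toHomPart {X Y Z : A} {i j n : ℕ} (e : j + i = n) (φ : radHom k X Y i)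
    (φ' : radHom k Y Z j) :
    compPart (hF Y) (hF Z) i j n e (toHomPart hF X Y i φ) (toHomPart hF Y Z j φ') =
      toHomPart hF X Z n ⟨φ.1 ≫ φ'.1, comp_mem_radHom e φ.2 φ'.2⟩ := by
  subst e
  obtain ⟨L, hg, hh⟩ := Ladder.exists_extension (hF Y) (hF Z) (j := j)
    ((single A).map (radLift φ')) (toHomPart hF Y Z j φ').1 (comp_toHomPart hF φ')
  obtain ⟨χ, hχ, hχ'⟩ := ladder_h_eq L _ hh i
  symm
  refine toHomPart_eq hF (ψ := radLift φ ≫ χ) ?_ ?_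
  · rw [Category.assoc, hχ', ← Category.assoc, radLift_comp]
    exact congrArg (φ.1 ≫ ·) (radLift_comp φ')
  · change radε X 0 ≫ (toHomPart hF X Y i φ).1 ≫ induced (hF Y) (hF Z) _ i (j + i) rfl = _
    rw [induced_eq (hF Y) (hF Z) _ L hg, ← Category.assoc, comp_toHomPart, Functor.map_comp, ← hχ]
    exact (Category.assoc _ _ _).trans ((congrArg ((single A).map (radLift φ) ≫ ·)
      (L.comm₂ i (j + i) rfl)).trans (Category.assoc _ _ _).symm)

/-- The canonical functor `gr A ⥤ ℱ` exists as soon as the radical diagrams are filtered. -/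
noncomputable def canonicalFunctor : CanonicalFunctor k 𝒮 where
  isFiltered := hF
  map := canonicalMap hF
  map_grMk X Y i ψ := by
    have e : (single A).map ψ ≫ radε Y i =
        radε X 0 ≫ (toHomPart (k := k) hF X Y i ⟨ψ ≫ radPowι Y i, mem_radHom.2 ⟨ψ, rfl⟩⟩).1 := by
      rw [comp_toHomPart, ← eq_radLift (k := k) ⟨ψ ≫ radPowι Y i, mem_radHom.2 ⟨ψ, rfl⟩⟩ rfl]
    exact ⟨_, e, canonicalMap_grMk hF _⟩
  map_id X := by
    rw [canonicalMap_grMk]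
    refine congrArg _ (toHomPart_eq hF (ψ := 𝟙 X) (Category.id_comp _) ?_)
    exact (Category.comp_id (radε X 0)).trans ((congrArg (· ≫ radε X 0)
      ((single A).map_id X)).trans (Category.id_comp (radε X 0))).symm
  map_comp X Y Z x y := by
    induction x using gHom_induction with
    | h0 => simp
    | hadd x x' h h' => simp only [map_add, LinearMap.add_apply, h, h']
    | hmk i φ hφ =>
    induction y using gHom_induction with
    | h0 => simp
    | hadd x x' h h' => simp only [map_add, h, h']
    | hmk j φ' hφ' =>
    rw [grComp_mk i j (j + i) rfl, canonicalMap_grMk, canonicalMap_grMk, canonicalMap_grMk,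
      dComp_lof (hF Y) (hF Z) i j (j + i) rfl, compPart_toHomPart]

/-- Homogeneous classes span the graded space, and on each of them `map_grMk` fixes the composite
with `ε₀`, hence the value. Thus bijectivity of `canonicalMap` passes to every `Φ`. -/
lemma CanonicalFunctor.map_eq (Φ : CanonicalFunctor k 𝒮) (X Y : A) :
    Φ.map X Y = canonicalMap Φ.isFiltered X Y := by
  refine LinearMap.ext fun x => ?_
  induction x using gHom_induction with
  | h0 => rw [map_zero, map_zero]
  | hadd x y hx hy => rw [map_add, map_add, hx, hy]
  | hmk i φ h =>
    obtain ⟨ψ, rfl⟩ := mem_radHom.1 h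
    obtain ⟨g, e, hg⟩ := Φ.map_grMk X Y i ψ
    rw [hg, canonicalMap_grMk]
    exact congrArg _ (toHomPart_eq Φ.isFiltered rfl e.symm).symm

end CanonicalMap

/-! ### Essential surjectivity. -/

section EssSurj

/-- An isomorphism of the initial maps `M₀ ⟶ N₀` gives an isomorphism of filtered objects. -/
lemma FilteredObject.nonempty_iso {T : Type u} [Category.{v} T] [Preadditive T] [HasZeroObject T]
    [HasShift T ℤ] [∀ n : ℤ, (shiftFunctor T n).Additive] [Pretriangulated T] {k : Type t} [Field k]
    [Linear k T] [∀ n : ℤ, (shiftFunctor T n).Linear k] {S : ObjectProperty T}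
    {M M' : FilteredObject k S} (a : M.diagram.M 0 ≅ M'.diagram.M 0)
    (b : M.diagram.N 0 ≅ M'.diagram.N 0)
    (h : a.hom ≫ M'.diagram.ε 0 = M.diagram.ε 0 ≫ b.hom) : Nonempty (M ≅ M') := by
  have h' : a.inv ≫ M.diagram.ε 0 = M'.diagram.ε 0 ≫ b.inv := by
    rw [Iso.inv_comp_eq, ← Category.assoc, h, Category.assoc, Iso.hom_inv_id, Category.comp_id]
  -- In degree `0` the composite in `ℱ` is the composite of the maps on `N₀`, since the ladder on
  -- `g'` starts with `g'` itself.
  have key {M M' : FilteredObject k S} (g : homPart k M.diagram M'.diagram 0)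
      (g' : homPart k M'.diagram M.diagram 0) (hg : g.1 ≫ g'.1 = 𝟙 _) :
      dComp M.diagram M'.isFiltered M.isFiltered
        (DirectSum.lof k ℕ (fun i => homPart k M.diagram M'.diagram i) 0 g)
        (DirectSum.lof k ℕ (fun i => homPart k M'.diagram M.diagram i) 0 g') = dId M.diagram := by
    rw [dComp_lof M'.isFiltered M.isFiltered 0 0 0 rfl, dId]
    refine congrArg _ (Subtype.ext ?_)
    refine Eq.trans ?_ hg
    exact congrArg (g.1 ≫ ·) (ladder_zero M'.isFiltered M.isFiltered g')
  exact ⟨{  hom := DirectSum.lof k ℕ (fun i => homPart k M.diagram M'.diagram i) 0 ⟨b.hom, a.hom, h⟩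
            inv := DirectSum.lof k ℕ (fun i => homPart k M'.diagram M.diagram i) 0 ⟨b.inv, a.inv, h'⟩
            hom_inv_id := key _ _ b.hom_inv_id
            inv_hom_id := key _ _ b.inv_hom_id }⟩

variable {A : Type u} [Category.{v} A] [Abelian A] [HasDerivedCategory.{w} A] {𝒮 : Set A}

/-- The objects `Mᵢ` of a filtered object are in the heart. -/
lemma Diagram.IsFiltered.essImage {D : Diagram (DerivedCategory.Bounded A)}
    (hD : D.IsFiltered (singleImage 𝒮)) (i : ℕ) : (single A).essImage (D.M i) := by
  obtain ⟨n, hn⟩ := hD.eventually_isZero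
  -- Descending induction on `i`, with `j` bounding the distance to the vanishing range: `Mᵢ` is an
  -- extension of `Nᵢ` by `Mᵢ₊₁`.
  suffices H : ∀ j i, n ≤ i + j → (single A).essImage (D.M i) from H n i (by omega)
  intro j
  induction j with
  | zero =>
    intro i hi
    exact ⟨_, ⟨((single A).map_isZero (isZero_zero A)).iso (hn i hi)⟩⟩
  | succ j ih =>
    intro i hi
    obtain ⟨Y, -, ⟨e⟩⟩ := exists_iso_single_of_addClosure (hD.add i)
    exact single_essImage_of_distinguished (hD.triangle i) (ih (i + 1) (by omega)) ⟨Y, ⟨e.symm⟩⟩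

variable [∀ X : A, IsArtinianObject X]

/-- The start `M₀ ⟶ N₀` of a filtered object is isomorphic to some `X ⟶ X / rad X`. -/
lemma Diagram.IsFiltered.exists_iso_radDiagram (h_simple : ∀ S ∈ 𝒮, Simple S)
    (h_rep : ∀ X : A, Simple X → ∃ S ∈ 𝒮, Nonempty (X ≅ S))
    {D : Diagram (DerivedCategory.Bounded A)} (hD : D.IsFiltered (singleImage 𝒮)) :
    ∃ (X : A) (a : (radDiagram X).M 0 ≅ D.M 0) (b : (radDiagram X).N 0 ≅ D.N 0),
      a.hom ≫ D.ε 0 = (radDiagram X).ε 0 ≫ b.hom := by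
  obtain ⟨X, ⟨a⟩⟩ := hD.essImage 0
  obtain ⟨Y, hY, ⟨b⟩⟩ := exists_iso_single_of_addClosure (hD.add 0)
  obtain ⟨p, hp⟩ := (single A).map_surjective (a.hom ≫ D.ε 0 ≫ b.hom)
  have : Epi p := by
    -- The first triangle of `D`, transported along `a` and `b` so that its second map is the image
    -- of `p`.
    refine epi_of_distinguished (hD.essImage 1) (f := D.f 0 ≫ a.inv) (δ := b.inv ≫ D.δ 0)
      (isomorphic_distinguished _ (hD.triangle 0) _
        (Triangle.isoMk _ _ (Iso.refl _) a b.symm ?_ ?_ ?_))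
    · change (D.f 0 ≫ a.inv) ≫ a.hom = 𝟙 _ ≫ D.f 0
      rw [Category.assoc, a.inv_hom_id, Category.comp_id, Category.id_comp]
    · change (single A).map p ≫ b.inv = a.hom ≫ D.ε 0
      rw [hp, Category.assoc, Category.assoc, b.hom_inv_id, Category.comp_id]
    · change (b.inv ≫ D.δ 0) ≫ (𝟙 (D.M 1))⟦(1 : ℤ)⟧' = b.inv ≫ D.δ 0
      rw [CategoryTheory.Functor.map_id, Category.comp_id]
  -- Condition `surjective₀`, carried to `A` by fullness, says that maps from `X` to members of `𝒮`
  -- factor through `p`; hence `p` is the quotient by the radical.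
  obtain ⟨c, hc⟩ := exists_iso_cokernel_radical h_simple h_rep hY p fun S hS e => by
    obtain ⟨r, hr⟩ := hD.surjective₀ _ ⟨S, hS, rfl⟩ (a.inv ≫ (single A).map e)
    obtain ⟨s, hs⟩ := (single A).map_surjective (b.inv ≫ r)
    refine ⟨s, (single A).map_injective ?_⟩
    change D.ε 0 ≫ r = _ at hr
    rw [Functor.map_comp, hp, hs, Category.assoc, Category.assoc, b.hom_inv_id_assoc, hr,
      a.hom_inv_id_assoc]
  refine ⟨X, a, (single A).mapIso c ≪≫ b.symm, ?_⟩
  change a.hom ≫ D.ε 0 =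
    (single A).map (cokernel.π (radical X).arrow) ≫ (single A).map c.hom ≫ b.inv
  rw [← Functor.map_comp_assoc, hc, hp, Category.assoc, Category.assoc, b.hom_inv_id,
    Category.comp_id]

end EssSurj

end RadicalGraded

theorem mainTheorem12 (k : Type t) [Field k] (A : Type u) [Category.{v} A] [Abelian A]
    [Linear k A] [HasDerivedCategory.{w} A]
    [∀ X : A, IsArtinianObject X] [∀ X : A, IsNoetherianObject X]
    (𝒮 : Set A) (h_finite : 𝒮.Finite) (h_simple : ∀ X ∈ 𝒮, Simple X)
    (h_rep : ∀ X : A, Simple X → ∃! S : A, S ∈ 𝒮 ∧ Nonempty (X ≅ S))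
    (h_split : ∀ X : A, Simple X → Nonempty (End X ≃ₐ[k] k)) :
    Nonempty (RadicalGraded.CanonicalFunctor k 𝒮) ∧
      ∀ Φ : RadicalGraded.CanonicalFunctor k 𝒮, Φ.toFunctor.IsEquivalence := by
  have h_rep' (X : A) (hX : Simple X) : ∃ S ∈ 𝒮, Nonempty (X ≅ S) := (h_rep X hX).exists
  refine ⟨⟨RadicalGraded.canonicalFunctor
    (RadicalGraded.radDiagram_isFiltered h_simple h_rep')⟩, fun Φ => ?_⟩
  have hΦ (X Y : A) : Function.Bijective (Φ.map X Y) := by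
    rw [Φ.map_eq]
    exact RadicalGraded.canonicalMap_bijective _ X Y
  exact
    { faithful := ⟨fun {X Y} _ _ h => (hΦ X.obj Y.obj).1 h⟩
      full := ⟨fun {X Y} => (hΦ X.obj Y.obj).2⟩
      essSurj := ⟨fun D => by
        obtain ⟨X, a, b, h⟩ := D.isFiltered.exists_iso_radDiagram h_simple h_rep'
        exact ⟨⟨X⟩, RadicalGraded.FilteredObject.nonempty_iso a b h⟩⟩ }
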